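/- Theorem (CH). Assume the continuum hypothesis. Let $I$ be a countable set, let $D$ be a nonprincipal ultrafilter on $I$, and let $\prod_D\omega$ be the ultrapower of the ordered semigroup $(\omega,+,\le)$. A convex subsemigroup of $\prod_D\omega$ is a subset $\Delta$ that contains $0$, is closed under addition, and contains every element lying between two of its elements (so that $\Delta$ is an initial segment). Isomorphism means isomorphism of ordered semigroups. The archimedean classes of $\Delta$ are the classes of nonzero elements of $\Delta$ under the relation "$a\le nb$ and $b\le ma$ for some $n,m\in\mathbb{N}$", ordered by: the class of $a$ is below or equal to that of $b$ iff $a\le nb$ for some $n\in\mathbb{N}$. $\Delta$ is called nonstandard if it contains an element larger than every standard natural number. The cofinality of $\Delta$ is the least cardinality of a cofinal subset. Then there are exactly $5$ isomorphism types of convex subsemigroups $\Delta$ of $\prod_D\omega$, namely the types of (i) $\{0\}$; (ii) $\omega$ (the classes of the constant functions); (iii) $\Delta$ of cofinality $\aleph_1$; (iv) $\Delta$ of cofinality $\aleph_0$ with no top archimedean class; (v) $\Delta$ nonstandard, of cofinality $\aleph_0$, with a top archimedean class. That is, every convex subsemigroup of $\prod_D\omega$ satisfies exactly one of the descriptions (i)–(v),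 each of them is satisfied by some convex subsemigroup, and two convex subsemigroups are isomorphic if and only if they satisfy the same description. -/

import Mathlib

universe u

/-- The ultrapower `∏_D ω`, with pointwise addition and the ultrapower order. -/
abbrev NatUltrapower {I : Type u} (D : Ultrafilter I) : Type u := (D : Filter I).Germ ℕ

/-- A convex subsemigroup of `∏_D ω`. Semigroups of values contain `0`, so that the convex ones
are initial segments. -/
structure ConvexSubsemigroup {I : Type u} (D : Ultrafilter I)
    extends AddSubmonoid (NatUltrapower D) where
  /-- Everything between two elements of the subsemigroup is in the subsemigroup. -/
  ordConnected' : carrier.OrdConnected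

namespace ConvexSubsemigroup

variable {I : Type u} {D : Ultrafilter I}

instance : CoeSort (ConvexSubsemigroup D) (Type u) := ⟨fun Δ => Δ.toAddSubmonoid⟩

/-- Isomorphism of convex subsemigroups as ordered semigroups. -/
def Iso (Δ Δ' : ConvexSubsemigroup D) : Prop := Nonempty (Δ ≃+o Δ')

variable (D) in
/-- The equivalence relation whose classes are the isomorphism types of convex subsemigroups. -/
def isoSetoid : Setoid (ConvexSubsemigroup D) where
  r := Iso
  iseqv :=
    { refl := fun _ => ⟨OrderAddMonoidIso.refl _⟩
      symm := fun ⟨e⟩ => ⟨e.symm⟩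
      trans := fun ⟨e⟩ ⟨f⟩ => ⟨e.trans f⟩ }

variable (D) in
/-- The copy of `ω` in `∏_D ω`, consisting of the (classes of) constant functions. -/
def standardCopy : AddSubmonoid (NatUltrapower D) :=
  AddMonoidHom.mrange (Nat.castAddMonoidHom (NatUltrapower D))

end ConvexSubsemigroup

/-- The nonzero elements of an ordered commutative monoid (meant: one whose least element is `0`),
preordered by `a ≲ b` iff `a ≤ n b` for some natural number `n`. -/
structure ArchimedeanPreorder (M : Type u) [AddCommMonoid M] where
  /-- The underlying element. -/
  val : M
  ne_zero : val ≠ 0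

instance {M : Type u} [AddCommMonoid M] [PartialOrder M] [IsOrderedAddMonoid M] :
    Preorder (ArchimedeanPreorder M) where
  le a b := ∃ n : ℕ, a.val ≤ n • b.val
  le_refl a := ⟨1, by rw [one_nsmul]⟩
  le_trans a b c := by
    rintro ⟨n, hn⟩ ⟨m, hm⟩
    refine ⟨m * n, hn.trans ?_⟩
    rw [mul_nsmul]
    exact nsmul_le_nsmul_right hm n

/-- Archimedean classes: nonzero `a` and `b` are in the same class iff `a ≤ n b` and `b ≤ m a` for
some natural numbers `n`, `m`. A class is larger if its elements are larger. -/
abbrev PosArchimedeanClass (M : Type u) [AddCommMonoid M] [PartialOrder M]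
    [IsOrderedAddMonoid M] : Type u :=
  Antisymmetrization (ArchimedeanPreorder M) (· ≤ ·)

namespace ConvexSubsemigroup

variable {I : Type u} {D : Ultrafilter I}

/-- There is a largest archimedean class. -/
def HasTopClass (Δ : ConvexSubsemigroup D) : Prop :=
  ∃ c : PosArchimedeanClass Δ, IsTop c

/-- `Δ` is nonstandard: it has an element above all standard natural numbers. -/
def Nonstandard (Δ : ConvexSubsemigroup D) : Prop :=
  ∃ x ∈ Δ.toAddSubmonoid, ∀ n : ℕ, (n : NatUltrapower D) < x

/-- The five descriptions of convex subsemigroups. -/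
def HasKind (Δ : ConvexSubsemigroup D) : Fin 5 → Prop
  | 0 => Δ.toAddSubmonoid = ⊥
  | 1 => Δ.toAddSubmonoid = standardCopy D
  | 2 => Order.cof Δ = Cardinal.aleph 1
  | 3 => Order.cof Δ = Cardinal.aleph0 ∧ ¬ Δ.HasTopClass
  | 4 => Δ.Nonstandard ∧ Order.cof Δ = Cardinal.aleph0 ∧ Δ.HasTopClass

end ConvexSubsemigroup

/-! The ultrapower of `ℤ` contains that of `ω` as its nonnegative part, and `Δ` generates there a
convex subgroup `Δ.hull`. An isomorphism of hulls is built by a back-and-forth of length `ω₁` from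
countable partial isomorphisms whose domain and range are pure and which preserve order and all
residues modulo standard numbers.

The crucial step is `IsPartialIso.exists_extension`. If `b` is outside the domain, its distance from
each domain element is infinite, because the order is discrete and `1` is in the domain. So
countable saturation finds `b'` in the corresponding cut of the range with the residues of `b`.
Equal residues mean equal remainders under division by `n`, so the cut of `b` also decides the sign
of `n * b - x`, and the map extends to the pure hull. The only obstruction is that the cut of `b'`
may have no upper bound inside the target group.

In cofinality `ℵ₁` a bound always exists, since ranges are countable. In cofinality `ℵ₀` the
construction starts from a partial isomorphism that is already cofinal on both sides: it is
generated by `1` and an infinite element of the top class, or by `1` and a cofinal sequence climbing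
through the classes. These elements are chosen divisible by all standard numbers, so that their
residues agree.

CH bounds the ultrapowers by `ℵ₁`: the back-and-forth has only `ℵ₁` tasks, and the cofinality of a
nonzero `Δ` is `ℵ₀` or `ℵ₁`. Conversely, cofinality and existence of a top class are isomorphism
invariants, and `ω` is recognised as generated by one element. -/

open Cardinal

/-! ### Chains of length `ω₁` -/

/-- A transfinite construction of length `ω₁`: if countable unions of chains of good sets are good
and each of at most `ℵ₁` many requirements can be met by enlarging a good set, then some chain of
good sets meets all the requirements. -/
theorem exists_chain_of_forall_extension {α : Type u} {T : Type u} (hT : #T ≤ aleph 1)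
    (Good : Set α → Prop) (Q : T → Set α → Prop)
    (hU : ∀ c : Set (Set α), c.Countable → c.Nonempty → IsChain (· ⊆ ·) c → (∀ S ∈ c, Good S) →
      Good (⋃₀ c))
    (hE : ∀ t S, Good S → ∃ S', S ⊆ S' ∧ Good S' ∧ Q t S') {S₀ : Set α} (h₀ : Good S₀) :
    ∃ c : Set (Set α), IsChain (· ⊆ ·) c ∧ c.Nonempty ∧ (∀ S ∈ c, Good S) ∧
      ∀ t, ∃ S ∈ c, Q t S := by
  classical
  rcases isEmpty_or_nonempty T with hT0 | hT0
  · exact ⟨{S₀}, IsChain.singleton, Set.singleton_nonempty _, by simpa using h₀,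
      fun t => (hT0.false t).elim⟩
  choose! E hE1 hE2 hE3 using hE
  have hW : #T ≤ #((aleph 1 : Cardinal.{u}).ord.ToType) := by simpa using hT
  obtain ⟨f⟩ := hW
  set W := (aleph 1 : Cardinal.{u}).ord.ToType
  let g : W → T := Function.invFun f
  have hg : Function.Surjective g := Function.invFun_surjective f.injective
  have wf : WellFounded ((· < ·) : W → W → Prop) := wellFounded_lt
  -- Stage `w` unites all earlier stages and then meets requirement `g w`. Including `S₀` keeps the
  -- united family nonempty at the first stage.
  let P : W → Set α := wf.fix fun w ih => E (g w) (⋃₀ ({S₀} ∪ Set.range fun v : Set.Iio w => ih v v.2))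
  have hP : ∀ w, P w = E (g w) (⋃₀ ({S₀} ∪ Set.range fun v : Set.Iio w => P v)) :=
    fun w => wf.fix_eq _ w
  -- Proper initial segments of `ω₁` are countable, so unions of countable chains suffice.
  have hcount : ∀ w : W, Countable (Set.Iio w) := fun w => by
    rw [← Cardinal.mk_le_aleph0_iff, ← Cardinal.lt_aleph_one_iff]
    simpa [W] using Cardinal.mk_Iio_lt w (by simp [W])
  have key : ∀ w, Good (⋃₀ ({S₀} ∪ Set.range fun v : Set.Iio w => P v)) ∧
      (⋃₀ ({S₀} ∪ Set.range fun v : Set.Iio w => P v)) ⊆ P w ∧ Good (P w) := by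
    intro w
    induction w using wf.induction with
    | _ w ih =>
    have hgood : Good (⋃₀ ({S₀} ∪ Set.range fun v : Set.Iio w => P v)) := by
      apply hU
      · have := hcount w
        exact (Set.countable_singleton _).union (Set.countable_range _)
      · exact ⟨S₀, by simp⟩
      · rintro A (rfl | ⟨v, rfl⟩) B (rfl | ⟨v', rfl⟩) hne
        · exact (hne rfl).elim
        · exact Or.inl ((Set.subset_sUnion_of_mem (by simp)).trans (ih v' v'.2).2.1)
        · exact Or.inr ((Set.subset_sUnion_of_mem (by simp)).trans (ih v v.2).2.1)
        · rcases lt_trichotomy v.1 v'.1 with h | h | h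
          · exact Or.inl ((Set.subset_sUnion_of_mem (Or.inr ⟨⟨v, h⟩, rfl⟩)).trans
              (ih v' v'.2).2.1)
          · exact (hne (by simp [h])).elim
          · exact Or.inr ((Set.subset_sUnion_of_mem (Or.inr ⟨⟨v', h⟩, rfl⟩)).trans
              (ih v v.2).2.1)
      · rintro A (rfl | ⟨v, rfl⟩)
        · exact h₀
        · exact (ih v v.2).2.2
    refine ⟨hgood, ?_, ?_⟩
    · rw [hP w]; exact hE1 _ _ hgood
    · rw [hP w]; exact hE2 _ _ hgood
  have hmono : ∀ v w, v < w → P v ⊆ P w := fun v w h =>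
    (Set.subset_sUnion_of_mem (Or.inr ⟨⟨v, h⟩, rfl⟩)).trans (key w).2.1
  refine ⟨Set.range P, ?_, ?_, ?_, ?_⟩
  · rintro _ ⟨v, rfl⟩ _ ⟨w, rfl⟩ hne
    rcases lt_trichotomy v w with h | h | h
    · exact Or.inl (hmono _ _ h)
    · exact (hne (by rw [h])).elim
    · exact Or.inr (hmono _ _ h)
  · obtain ⟨t⟩ := hT0
    exact ⟨_, f t, rfl⟩
  · rintro _ ⟨w, rfl⟩
    exact (key w).2.2
  · intro t
    obtain ⟨w, rfl⟩ := hg t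
    refine ⟨P w, ⟨w, rfl⟩, ?_⟩
    rw [hP w]
    exact hE3 _ _ (key w).1

/-! ### Partial isomorphisms and their one-step extension -/

/-- Discretely ordered rings with Euclidean division by standard numbers in which every countable
gap with infinite distance contains elements of every profinite residue. -/
class SaturatedIntegers (G : Type u) [CommRing G] [LinearOrder G] [IsStrictOrderedRing G] :
    Prop where
  one_le_of_pos : ∀ x : G, 0 < x → 1 ≤ x
  exists_rem : ∀ (x : G) (n : ℕ), 0 < n → ∃ r : ℕ, r < n ∧ (n : G) ∣ x - r
  exists_between : ∀ L U : Set G, L.Countable → U.Countable → L.Nonempty → U.Nonempty →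
    (∀ l ∈ L, ∀ u ∈ U, ∀ n : ℕ, l + n < u) → ∀ b : G,
    ∃ z, (∀ l ∈ L, l < z) ∧ (∀ u ∈ U, z < u) ∧ ∀ n : ℕ, 0 < n → (n : G) ∣ b - z

/-- A subgroup containing with `x` all elements of smaller absolute value. -/
def AddSubgroup.IsAbsConvex {G : Type u} [AddCommGroup G] [LinearOrder G] (H : AddSubgroup G) :
    Prop :=
  ∀ x ∈ H, ∀ y, |y| ≤ |x| → y ∈ H

section PartialIso

variable {G : Type u} [CommRing G] [LinearOrder G]

/-- Graphs of countable partial isomorphisms between pure subgroups of `H` and `H'` that respect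
the order and the residues modulo the standard numbers. -/
structure IsPartialIso (H H' : AddSubgroup G) (P : Set (G × G)) : Prop where
  countable : P.Countable
  one_mem : ((1 : G), (1 : G)) ∈ P
  sub_mem : ∀ {x y x' y'}, (x, y) ∈ P → (x', y') ∈ P → (x - x', y - y') ∈ P
  pure : ∀ {x y : G} {m : ℕ}, 0 < m → ((m : G) * x, (m : G) * y) ∈ P → (x, y) ∈ P
  nonneg_iff : ∀ {x y}, (x, y) ∈ P → (0 ≤ x ↔ 0 ≤ y)
  dvd : ∀ {x y}, (x, y) ∈ P → ∀ m : ℕ, 0 < m → (m : G) ∣ x - y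
  mem_left : ∀ {x y}, (x, y) ∈ P → x ∈ H
  mem_right : ∀ {x y}, (x, y) ∈ P → y ∈ H'

/-- `R` is the graph of an isomorphism between the nonnegative parts of `H` and `H'`, extended to
differences. -/
structure IsIsoGraph (H H' : AddSubgroup G) (R : Set (G × G)) : Prop where
  sub_mem : ∀ x y x' y', (x, y) ∈ R → (x', y') ∈ R → (x - x', y - y') ∈ R
  nonneg_iff : ∀ x y, (x, y) ∈ R → (0 ≤ x ↔ 0 ≤ y)
  mem : ∀ x y, (x, y) ∈ R → x ∈ H ∧ y ∈ H'
  left_total : ∀ x ∈ H, 0 ≤ x → ∃ y, (x, y) ∈ R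
  right_total : ∀ y ∈ H', 0 ≤ y → ∃ x, (x, y) ∈ R

theorem IsIsoGraph.swap {H H' : AddSubgroup G} {R : Set (G × G)} (h : IsIsoGraph H H' R) :
    IsIsoGraph H' H (Prod.swap ⁻¹' R) where
  sub_mem x y x' y' := h.sub_mem y x y' x'
  nonneg_iff x y hx := (h.nonneg_iff y x hx).symm
  mem x y hx := (h.mem y x hx).symm
  left_total := h.right_total
  right_total := h.left_total

/-- The pure hull of the group generated by `P` and `(b, b')`. -/
def pureHull (P : Set (G × G)) (b b' : G) : Set (G × G) :=
  {z | ∃ m : ℕ, 0 < m ∧ ∃ n : ℤ, ((m : G) * z.1 - n * b, (m : G) * z.2 - n * b') ∈ P}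

variable {H H' : AddSubgroup G} {P : Set (G × G)}

namespace IsPartialIso

theorem subset_pureHull {G : Type u} [CommRing G] (P : Set (G × G)) (b b' : G) : P ⊆ pureHull P b b' := by
  rintro ⟨x, y⟩ h
  exact ⟨1, one_pos, 0, by simpa using h⟩

theorem zero_mem (h : IsPartialIso H H' P) : ((0 : G), (0 : G)) ∈ P := by
  simpa using h.sub_mem h.one_mem h.one_mem

theorem neg_mem (h : IsPartialIso H H' P) {x y : G} (hx : (x, y) ∈ P) : (-x, -y) ∈ P := by
  simpa using h.sub_mem h.zero_mem hx

theorem add_mem (h : IsPartialIso H H' P) {x y x' y' : G} (hx : (x, y) ∈ P)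
    (hx' : (x', y') ∈ P) : (x + x', y + y') ∈ P := by
  simpa using h.sub_mem hx (h.neg_mem hx')

theorem natCast_mul_mem (h : IsPartialIso H H' P) {x y : G} (hx : (x, y) ∈ P) (n : ℕ) :
    ((n : G) * x, (n : G) * y) ∈ P := by
  induction n with
  | zero => simpa using h.zero_mem
  | succ n ih => push_cast; rw [add_one_mul, add_one_mul]; exact h.add_mem ih hx

theorem natCast_mem (h : IsPartialIso H H' P) (n : ℕ) : ((n : G), (n : G)) ∈ P := by
  simpa using h.natCast_mul_mem h.one_mem n

theorem swap (h : IsPartialIso H H' P) : IsPartialIso H' H (Prod.swap ⁻¹' P) where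
  countable := h.countable.preimage Prod.swap_injective
  one_mem := h.one_mem
  sub_mem h1 h2 := h.sub_mem h1 h2
  pure h1 h2 := h.pure h1 h2
  nonneg_iff h1 := (h.nonneg_iff h1).symm
  dvd h1 m hm := by simpa using (dvd_neg.2 (h.dvd h1 m hm))
  mem_left h1 := h.mem_right h1
  mem_right h1 := h.mem_left h1

theorem sUnion {c : Set (Set (G × G))} (hc : c.Countable) (hne : c.Nonempty)
    (hchain : IsChain (· ⊆ ·) c) (h : ∀ S ∈ c, IsPartialIso H H' S) :
    IsPartialIso H H' (⋃₀ c) where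
  countable := hc.sUnion fun S hS => (h S hS).countable
  one_mem := hne.elim fun S hS => ⟨S, hS, (h S hS).one_mem⟩
  sub_mem := by
    rintro x y x' y' ⟨S, hS, hx⟩ ⟨S', hS', hx'⟩
    rcases hchain.total hS hS' with hs | hs
    · exact ⟨S', hS', (h S' hS').sub_mem (hs hx) hx'⟩
    · exact ⟨S, hS, (h S hS).sub_mem hx (hs hx')⟩
  pure := by
    rintro x y m hm ⟨S, hS, hx⟩
    exact ⟨S, hS, (h S hS).pure hm hx⟩
  nonneg_iff := by
    rintro x y ⟨S, hS, hx⟩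
    exact (h S hS).nonneg_iff hx
  dvd := by
    rintro x y ⟨S, hS, hx⟩
    exact (h S hS).dvd hx
  mem_left := by
    rintro x y ⟨S, hS, hx⟩
    exact (h S hS).mem_left hx
  mem_right := by
    rintro x y ⟨S, hS, hx⟩
    exact (h S hS).mem_right hx

theorem mem_pureHull (h : IsPartialIso H H' P) (b b' : G) : (b, b') ∈ pureHull P b b' :=
  ⟨1, one_pos, 1, by simpa using h.zero_mem⟩

variable [IsStrictOrderedRing G]

theorem le_iff (h : IsPartialIso H H' P) {x y x' y' : G} (hx : (x, y) ∈ P)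
    (hx' : (x', y') ∈ P) : x ≤ x' ↔ y ≤ y' := by
  have := h.nonneg_iff (h.sub_mem hx' hx)
  rwa [sub_nonneg, sub_nonneg] at this

theorem lt_iff (h : IsPartialIso H H' P) {x y x' y' : G} (hx : (x, y) ∈ P)
    (hx' : (x', y') ∈ P) : x < x' ↔ y < y' := by
  rw [← not_le, ← not_le, h.le_iff hx' hx]

variable [SaturatedIntegers G]

/-- Since `n` divides `x - y`, both sides leave the same remainder; purity puts the pair of
quotients back into `P`. -/
theorem exists_floor (h : IsPartialIso H H' P) {x y : G} (hx : (x, y) ∈ P) {n : ℕ} (hn : 0 < n) :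
    ∃ c c' : G, ∃ r : ℕ, (c, c') ∈ P ∧ r < n ∧ x = n * c + r ∧ y = n * c' + r := by
  obtain ⟨r, hr, c, hc⟩ := SaturatedIntegers.exists_rem x n hn
  obtain ⟨d, hd⟩ := h.dvd hx n hn
  have h1 : x = n * c + r := by linear_combination hc
  have h2 : y = n * (c - d) + r := by linear_combination hc - hd
  refine ⟨c, c - d, r, h.pure hn ?_, hr, h1, h2⟩
  have := h.sub_mem hx (h.natCast_mem r)
  rw [h1, h2] at this
  simpa using this

theorem add_one_le {x y : G} (hxy : x < y) : x + 1 ≤ y := by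
  have := SaturatedIntegers.one_le_of_pos (y - x) (by linarith)
  linarith

/-- The sign conditions that make the extension of `P` by `(b, b')` order preserving follow from
the conditions for the cut of `b` in the domain of `P`. -/
theorem nonneg_iff_of_cut (h : IsPartialIso H H' P) {b b' : G}
    (hlt : ∀ x y, (x, y) ∈ P → x < b → y < b') (hgt : ∀ x y, (x, y) ∈ P → b < x → b' < y)
    (hb : ∀ y, (b, y) ∉ P) {x y : G} (hx : (x, y) ∈ P) {n : ℕ} (hn : 0 < n) :
    (n * b < x → n * b' < y) ∧ (x < n * b → y < n * b') ∧ x ≠ n * b := by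
  obtain ⟨c, c', r, hc, hr, rfl, rfl⟩ := h.exists_floor hx hn
  have hn' : (0 : G) < n := by exact_mod_cast hn
  have hr0 : (0 : G) ≤ r := by positivity
  have hr' : (r : G) < n := by exact_mod_cast hr
  -- If `c < b`, then `c + 1 ≤ b` by discreteness, so `n * c + r < n * (c + 1) ≤ n * b`. The
  -- remainder is therefore irrelevant, and the same holds for `c'` and `b'`.
  rcases lt_trichotomy c b with hcb | rfl | hcb
  · have h1 := add_one_le hcb
    have h2 := add_one_le (hlt _ _ hc hcb)
    have h3 : (n : G) * (c + 1) ≤ n * b := mul_le_mul_of_nonneg_left h1 hn'.le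
    have h4 : (n : G) * (c' + 1) ≤ n * b' := mul_le_mul_of_nonneg_left h2 hn'.le
    refine ⟨fun h => ?_, fun _ => by linarith, fun h => ?_⟩
    · linarith
    · linarith
  · exact (hb _ hc).elim
  · have h1 := mul_lt_mul_of_pos_left hcb hn'
    have h2 := mul_lt_mul_of_pos_left (hgt _ _ hc hcb) hn'
    refine ⟨fun h => by linarith, fun h => by linarith, fun h => by linarith⟩

theorem pureHull (h : IsPartialIso H H' P) (hH : H.IsAbsConvex) (hH' : H'.IsAbsConvex) {b b' : G}
    (hb : b ∈ H) (hb' : b' ∈ H')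
    (hlt : ∀ x y, (x, y) ∈ P → x < b → y < b') (hgt : ∀ x y, (x, y) ∈ P → b < x → b' < y)
    (hnot : ∀ y, (b, y) ∉ P) (hdvd : ∀ n : ℕ, 0 < n → (n : G) ∣ b - b') :
    IsPartialIso H H' (pureHull P b b') where
  countable := by
    -- For fixed `m` and `n` the defining condition is a preimage of `P` under an injection; only
    -- countably many pairs `(m, n)` occur.
    have hinj : ∀ (m : ℕ), 0 < m → ∀ n : ℤ, Function.Injective
        fun z : G × G => ((m : G) * z.1 - n * b, (m : G) * z.2 - n * b') := by
      rintro m hm n ⟨x, y⟩ ⟨x', y'⟩ hz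
      have hm' : (m : G) ≠ 0 := by exact_mod_cast hm.ne'
      simp only [Prod.mk.injEq, sub_left_inj, mul_right_inj' hm'] at hz
      exact Prod.ext hz.1 hz.2
    have : _root_.pureHull P b b' = ⋃ m : {m : ℕ // 0 < m}, ⋃ n : ℤ,
        (fun z : G × G => (((m : ℕ) : G) * z.1 - n * b, ((m : ℕ) : G) * z.2 - n * b')) ⁻¹' P := by
      ext z
      simp [_root_.pureHull]
    rw [this]
    exact Set.countable_iUnion fun m => Set.countable_iUnion fun n =>
      h.countable.preimage (hinj m m.2 n)
  one_mem := subset_pureHull _ _ _ h.one_mem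
  sub_mem := by
    rintro x y x' y' ⟨m, hm, n, hx⟩ ⟨m', hm', n', hx'⟩
    refine ⟨m * m', by positivity, m' * n - m * n', ?_⟩
    convert h.sub_mem (h.natCast_mul_mem hx m') (h.natCast_mul_mem hx' m) using 2 <;>
      push_cast <;> ring
  pure := by
    rintro x y m hm ⟨k, hk, n, hx⟩
    refine ⟨k * m, by positivity, n, ?_⟩
    convert hx using 2 <;> push_cast <;> ring
  nonneg_iff := by
    rintro x y ⟨m, hm, n, hx⟩
    dsimp only at hx
    have hm' : (0 : G) < m := by exact_mod_cast hm
    rw [← mul_nonneg_iff_of_pos_left hm', ← mul_nonneg_iff_of_pos_left (b := y) hm']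
    set p := (m : G) * x - n * b with hp
    set q := (m : G) * y - n * b' with hq
    have hp' : (m : G) * x = p + n * b := by rw [hp]; ring
    have hq' : (m : G) * y = q + n * b' := by rw [hq]; ring
    rw [hp', hq']
    obtain ⟨k, rfl | rfl⟩ := n.eq_nat_or_neg
    · rcases k.eq_zero_or_pos with rfl | hk
      · simpa using h.nonneg_iff hx
      · obtain ⟨h1, h2, h3⟩ := h.nonneg_iff_of_cut hlt hgt hnot (h.neg_mem hx) hk
        push_cast
        rcases lt_or_gt_of_ne h3 with h4 | h4
        · have := h2 h4
          constructor <;> intro <;> linarith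
        · have := h1 h4
          constructor <;> intro <;> linarith
    · rcases k.eq_zero_or_pos with rfl | hk
      · simpa using h.nonneg_iff hx
      · obtain ⟨h1, h2, h3⟩ := h.nonneg_iff_of_cut hlt hgt hnot hx hk
        push_cast
        rcases lt_or_gt_of_ne h3 with h4 | h4
        · have := h2 h4
          constructor <;> intro <;> linarith
        · have := h1 h4
          constructor <;> intro <;> linarith
  dvd := by
    rintro x y ⟨m, hm, n, hx⟩ k hk
    have hm' : (m : G) ≠ 0 := by exact_mod_cast hm.ne'
    -- Divisibility is taken modulo `m * k`, because `m` is cancelled at the end.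
    have h1 := h.dvd hx (m * k) (by positivity)
    have h2 := (hdvd (m * k) (by positivity)).mul_left (n : G)
    have h3 := dvd_add h1 h2
    rw [Nat.cast_mul] at h3
    rw [← mul_dvd_mul_iff_left hm']
    convert h3 using 1
    ring
  mem_left := by
    rintro x y ⟨m, hm, n, hx⟩
    have h1 := H.add_mem (h.mem_left hx) (H.zsmul_mem hb n)
    refine hH _ h1 _ ?_
    have h2 : (m : G) * x - n * b + n • b = m * x := by rw [zsmul_eq_mul]; ring
    have hm' : (1 : G) ≤ m := by exact_mod_cast hm
    rw [h2, abs_mul, Nat.abs_cast]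
    exact le_mul_of_one_le_left (abs_nonneg _) hm'
  mem_right := by
    rintro x y ⟨m, hm, n, hx⟩
    have h1 := H'.add_mem (h.mem_right hx) (H'.zsmul_mem hb' n)
    refine hH' _ h1 _ ?_
    have h2 : (m : G) * y - n * b' + n • b' = m * y := by rw [zsmul_eq_mul]; ring
    have hm' : (1 : G) ≤ m := by exact_mod_cast hm
    rw [h2, abs_mul, Nat.abs_cast]
    exact le_mul_of_one_le_left (abs_nonneg _) hm'

/-- A partial isomorphism extends to every positive element whose cut in the domain is bounded. -/
theorem exists_extension (h : IsPartialIso H H' P) (hH : H.IsAbsConvex) (hH' : H'.IsAbsConvex)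
    {b : G} (hb : b ∈ H) (hb0 : 0 ≤ b)
    (hbd : ∃ d ∈ H', ∀ x y, (x, y) ∈ P → x < b → y < d) :
    ∃ Q, P ⊆ Q ∧ IsPartialIso H H' Q ∧ ∃ b', (b, b') ∈ Q := by
  by_cases hdom : ∃ y, (b, y) ∈ P
  · exact ⟨P, subset_rfl, h, hdom⟩
  push Not at hdom
  obtain ⟨d, hd, hd'⟩ := hbd
  have hb0' : 0 < b := hb0.lt_of_ne (by rintro rfl; exact hdom _ h.zero_mem)
  -- The domain is closed under adding standard numbers, so a finite distance to `b` would put `b`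
  -- into it.
  have shift : ∀ x y, (x, y) ∈ P → x < b → ∀ n : ℕ, x + n < b := by
    intro x y hx hxb n
    induction n with
    | zero => simpa using hxb
    | succ n ih =>
      have h1 := add_one_le ih
      refine lt_of_le_of_ne (by push_cast; linarith) ?_
      rintro rfl
      exact hdom _ (h.add_mem hx (h.natCast_mem (n + 1)))
  let L : Set G := Prod.snd '' {z ∈ P | z.1 < b}
  -- The bound `d` keeps `b'` inside the convex group `H'`, and makes `U` nonempty when `b` lies
  -- above the whole domain.
  let U : Set G := insert d (Prod.snd '' {z ∈ P | b < z.1})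
  obtain ⟨b', hL, hU, hdvd⟩ := SaturatedIntegers.exists_between L U
    ((h.countable.mono (Set.sep_subset _ _)).image _)
    (((h.countable.mono (Set.sep_subset _ _)).image _).insert _)
    ⟨0, (0, 0), ⟨h.zero_mem, hb0'⟩, rfl⟩ ⟨d, Set.mem_insert _ _⟩ (by
      rintro _ ⟨⟨x, y⟩, ⟨hx, hxb⟩, rfl⟩ u hu n
      have h1 := shift x y hx hxb n
      have h2 := h.add_mem hx (h.natCast_mem n)
      rcases hu with rfl | ⟨⟨x', y'⟩, ⟨hx', hxb'⟩, rfl⟩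
      · exact hd' _ _ h2 h1
      · exact (h.lt_iff h2 hx').1 (h1.trans hxb')) b
  have hb'0 : 0 < b' := hL 0 ⟨(0, 0), ⟨h.zero_mem, hb0'⟩, rfl⟩
  have hb'd : b' < d := hU d (Set.mem_insert _ _)
  have hb' : b' ∈ H' := hH' d hd b' (abs_le_abs_of_nonneg hb'0.le hb'd.le)
  exact ⟨_, subset_pureHull _ _ _, h.pureHull hH hH' hb hb'
    (fun x y hx hxb => hL y ⟨(x, y), ⟨hx, hxb⟩, rfl⟩)
    (fun x y hx hxb => hU y (Or.inr ⟨(x, y), ⟨hx, hxb⟩, rfl⟩)) hdom hdvd, b', h.mem_pureHull b b'⟩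

end IsPartialIso

end PartialIso

theorem intCast_lt_of_natCast_lt {G : Type u} [CommRing G] [LinearOrder G] [IsStrictOrderedRing G]
    {x : G} (h : ∀ n : ℕ, (n : G) < x) (n : ℤ) : (n : G) < x :=
  lt_of_le_of_lt (by exact_mod_cast Int.self_le_toNat n) (h n.toNat)

/-- Used to see that adjoining `b` and taking the pure hull produces nothing beyond the multiples of
`b`, hence nothing above an element of a higher class. -/
theorem lt_of_mul_sub_mul_lt {G : Type u} [CommRing G] [LinearOrder G] [IsStrictOrderedRing G]
    {p b c : G} {m : ℕ} {j : ℤ} (hm : 0 < m) (hb : 0 < b)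
    (h : m * p - j * b < b) (hc : ∀ k : ℕ, (k : G) * b < c) : p < c := by
  rcases lt_or_ge p 0 with hp | hp
  · have := hc 0
    simp only [Nat.cast_zero, zero_mul] at this
    exact hp.trans this
  · have hm' : (1 : G) ≤ m := by exact_mod_cast hm
    have h1 : p ≤ m * p := le_mul_of_one_le_left hp hm'
    have h2 : ((j + 1 : ℤ) : G) ≤ (j + 1).toNat := by exact_mod_cast Int.self_le_toNat (j + 1)
    have h3 := mul_le_mul_of_nonneg_right h2 hb.le
    have h4 := hc (j + 1).toNat
    push_cast at h3
    linarith

/-! ### Back-and-forth -/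

section PartialIso

variable {G : Type u} [CommRing G] [LinearOrder G] [IsStrictOrderedRing G] [SaturatedIntegers G]
  {H H' : AddSubgroup G} {P : Set (G × G)}

namespace IsPartialIso

/-- The identity of the standard integers. -/
theorem diagonal (h1 : (1 : G) ∈ H) (h1' : (1 : G) ∈ H') :
    IsPartialIso H H' (Set.range fun n : ℤ => ((n : G), (n : G))) where
  countable := Set.countable_range _
  one_mem := ⟨1, by simp⟩
  sub_mem := by
    rintro x y x' y' ⟨n, hn⟩ ⟨n', hn'⟩
    simp only [Prod.mk.injEq] at hn hn'
    refine ⟨n - n', ?_⟩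
    simp [← hn.1, ← hn.2, ← hn'.1, ← hn'.2]
  pure := by
    -- Here `m * (x - n / m) = n % m` lies in `[0, m)`, so `0 ≤ x - n / m < 1`, and discreteness
    -- makes it zero.
    have key : ∀ (x : G) (m : ℕ) (n : ℤ), 0 < m → (n : G) = m * x → x = (n / m : ℤ) := by
      intro x m n hm hx
      have hm' : (0 : G) < m := by exact_mod_cast hm
      have h1 : (m : G) * (x - (n / m : ℤ)) = (n % m : ℤ) := by
        rw [mul_sub, ← hx, sub_eq_iff_eq_add]
        exact_mod_cast (Int.emod_add_mul_ediv n m).symm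
      have h2 : 0 ≤ n % m := Int.emod_nonneg _ (by positivity)
      have h3 : n % m < m := Int.emod_lt_of_pos _ (by positivity)
      have h2' : (0 : G) ≤ (m : G) * (x - (n / m : ℤ)) := by rw [h1]; exact_mod_cast h2
      have h3' : (m : G) * (x - (n / m : ℤ)) < m := by rw [h1]; exact_mod_cast h3
      have h4 : 0 ≤ x - (n / m : ℤ) := (mul_nonneg_iff_of_pos_left hm').1 h2'
      rcases h4.eq_or_lt with h5 | h5
      · linarith
      · have h6 := mul_le_mul_of_nonneg_left (SaturatedIntegers.one_le_of_pos _ h5) hm'.le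
        linarith
    rintro x y m hm ⟨n, hn⟩
    simp only [Prod.mk.injEq] at hn
    exact ⟨n / m, Prod.ext (key x m n hm hn.1).symm (key y m n hm hn.2).symm⟩
  nonneg_iff := by
    rintro x y ⟨n, hn⟩
    simp only [Prod.mk.injEq] at hn
    rw [← hn.1, ← hn.2]
  dvd := by
    rintro x y ⟨n, hn⟩ m hm
    simp only [Prod.mk.injEq] at hn
    simp [← hn.1, ← hn.2]
  mem_left := by
    rintro x y ⟨n, hn⟩
    simp only [Prod.mk.injEq] at hn
    simpa [← hn.1] using H.zsmul_mem h1 n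
  mem_right := by
    rintro x y ⟨n, hn⟩
    simp only [Prod.mk.injEq] at hn
    simpa [← hn.2] using H'.zsmul_mem h1' n

/-- Elements above the domain and the range may be related, if all standard numbers divide them. -/
theorem pureHull_of_lt (h : IsPartialIso H H' P) (hH : H.IsAbsConvex) (hH' : H'.IsAbsConvex)
    {b b' : G} (hb : b ∈ H) (hb' : b' ∈ H') (hlt : ∀ x y, (x, y) ∈ P → x < b ∧ y < b')
    (hd : ∀ n : ℕ, 0 < n → (n : G) ∣ b) (hd' : ∀ n : ℕ, 0 < n → (n : G) ∣ b') :
    IsPartialIso H H' (_root_.pureHull P b b') :=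
  h.pureHull hH hH' hb hb' (fun x y hx _ => (hlt x y hx).2)
    (fun x y hx hxb => ((hlt x y hx).1.not_gt hxb).elim)
    (fun y hy => (hlt b y hy).1.false) fun n hn => dvd_sub (hd n hn) (hd' n hn)

/-- A partial isomorphism all of whose extensions can be extended further to any given element is
contained in the graph of an isomorphism between `H` and `H'`. -/
theorem exists_total (hG : #G ≤ aleph 1) (h : IsPartialIso H H' P) (hH : H.IsAbsConvex)
    (hH' : H'.IsAbsConvex)
    (hbd : ∀ Q, P ⊆ Q → IsPartialIso H H' Q → ∀ b ∈ H, ∃ d ∈ H', ∀ x y, (x, y) ∈ Q → x < b → y < d)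
    (hbd' : ∀ Q, P ⊆ Q → IsPartialIso H H' Q →
      ∀ b ∈ H', ∃ d ∈ H, ∀ x y, (x, y) ∈ Q → y < b → x < d) :
    ∃ R, IsIsoGraph H H' R := by
  -- The left summand indexes the "forth" requirements, the right summand the "back" requirements.
  have hT : #(G ⊕ G) ≤ aleph 1 := by
    rw [mk_sum, lift_id]
    exact (add_le_max _ _).trans (max_le (max_le hG hG) (aleph0_le_aleph 1))
  obtain ⟨c, hchain, hne, hgood, hQ⟩ := exists_chain_of_forall_extension hT
    (fun S : Set (G × G) => P ⊆ S ∧ IsPartialIso H H' S)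
    (fun t S => t.elim (fun b => b ∈ H → 0 ≤ b → ∃ y, (b, y) ∈ S)
      (fun b => b ∈ H' → 0 ≤ b → ∃ x, (x, b) ∈ S))
    (fun c hc hne hchain hS => by
      refine ⟨?_, IsPartialIso.sUnion hc hne hchain fun S h => (hS S h).2⟩
      obtain ⟨S, h⟩ := hne
      exact (hS S h).1.trans (Set.subset_sUnion_of_mem h))
    (by
      rintro (b | b) S ⟨hPS, hS⟩
      · by_cases hb : b ∈ H ∧ 0 ≤ b
        · obtain ⟨Q, h1, h2, h3⟩ := hS.exists_extension hH hH' hb.1 hb.2 (hbd S hPS hS b hb.1)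
          exact ⟨Q, h1, ⟨hPS.trans h1, h2⟩, fun _ _ => h3⟩
        · exact ⟨S, subset_rfl, ⟨hPS, hS⟩, fun h1 h2 => (hb ⟨h1, h2⟩).elim⟩
      · by_cases hb : b ∈ H' ∧ 0 ≤ b
        · obtain ⟨d, hd, hd'⟩ := hbd' S hPS hS b hb.1
          obtain ⟨Q, h1, h2, h3⟩ := hS.swap.exists_extension hH' hH hb.1 hb.2
            ⟨d, hd, fun x y => hd' y x⟩
          have h1' : S ⊆ Prod.swap ⁻¹' Q := fun z hz => h1 (by simpa using hz)
          exact ⟨Prod.swap ⁻¹' Q, h1', ⟨hPS.trans h1', h2.swap⟩, fun _ _ => h3⟩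
        · exact ⟨S, subset_rfl, ⟨hPS, hS⟩, fun h1 h2 => (hb ⟨h1, h2⟩).elim⟩)
    ⟨subset_rfl, h⟩
  refine ⟨⋃₀ c, ?_, ?_, ?_, ?_, ?_⟩
  · rintro x y x' y' ⟨S, hS, hx⟩ ⟨S', hS', hx'⟩
    rcases hchain.total hS hS' with hs | hs
    · exact ⟨S', hS', (hgood S' hS').2.sub_mem (hs hx) hx'⟩
    · exact ⟨S, hS, (hgood S hS).2.sub_mem hx (hs hx')⟩
  · rintro x y ⟨S, hS, hx⟩
    exact (hgood S hS).2.nonneg_iff hx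
  · rintro x y ⟨S, hS, hx⟩
    exact ⟨(hgood S hS).2.mem_left hx, (hgood S hS).2.mem_right hx⟩
  · intro x hx hx0
    obtain ⟨S, hS, h1⟩ := hQ (Sum.inl x)
    obtain ⟨y, hy⟩ := h1 hx hx0
    exact ⟨y, S, hS, hy⟩
  · intro x hx hx0
    obtain ⟨S, hS, h1⟩ := hQ (Sum.inr x)
    obtain ⟨y, hy⟩ := h1 hx hx0
    exact ⟨y, S, hS, hy⟩

end IsPartialIso

/-- A pair `(p, q)` in `P` with `b ≤ p` supplies the bound `q` for the image of the cut of `b`, in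
every extension of `P`. -/
theorem IsPartialIso.exists_isIsoGraph_of_cofinal (hG : #G ≤ aleph 1) (h : IsPartialIso H H' P)
    (hH : H.IsAbsConvex) (hH' : H'.IsAbsConvex)
    (hcof : ∀ b ∈ H, ∃ z ∈ P, b ≤ z.1) (hcof' : ∀ b ∈ H', ∃ z ∈ P, b ≤ z.2) :
    ∃ R, IsIsoGraph H H' R := by
  exact h.exists_total hG hH hH'
    (fun Q hPQ hQ b hb => by
      obtain ⟨⟨p, q⟩, hz, hbz⟩ := hcof b hb
      exact ⟨q, h.mem_right hz, fun x y hx hxb => (hQ.lt_iff hx (hPQ hz)).1 (hxb.trans_le hbz)⟩)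
    (fun Q hPQ hQ b hb => by
      obtain ⟨⟨p, q⟩, hz, hbz⟩ := hcof' b hb
      exact ⟨p, h.mem_left hz, fun x y hx hxb => (hQ.lt_iff hx (hPQ hz)).2 (hxb.trans_le hbz)⟩)

/-- The domain and range of every partial isomorphism are countable, hence bounded, so the identity
of the standard integers can serve as the start. -/
theorem exists_isIsoGraph_of_uncountable_cof (hG : #G ≤ aleph 1) (hH : H.IsAbsConvex)
    (hH' : H'.IsAbsConvex) (h1 : (1 : G) ∈ H) (h1' : (1 : G) ∈ H')
    (hcof : ∀ C : Set G, C.Countable → C ⊆ H → ∃ d ∈ H, ∀ c ∈ C, c < d)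
    (hcof' : ∀ C : Set G, C.Countable → C ⊆ H' → ∃ d ∈ H', ∀ c ∈ C, c < d) :
    ∃ R, IsIsoGraph H H' R := by
  exact (IsPartialIso.diagonal h1 h1').exists_total hG hH hH'
    (fun Q hPQ hQ b hb => by
      obtain ⟨d, hd, hd'⟩ := hcof' (Prod.snd '' Q) (hQ.countable.image _) (by
        rintro _ ⟨⟨x, y⟩, hx, rfl⟩
        exact hQ.mem_right hx)
      exact ⟨d, hd, fun x y hx _ => hd' y ⟨_, hx, rfl⟩⟩)
    (fun Q hPQ hQ b hb => by
      obtain ⟨d, hd, hd'⟩ := hcof (Prod.fst '' Q) (hQ.countable.image _) (by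
        rintro _ ⟨⟨x, y⟩, hx, rfl⟩
        exact hQ.mem_left hx)
      exact ⟨d, hd, fun x y hx _ => hd' x ⟨_, hx, rfl⟩⟩)

theorem exists_isIsoGraph_of_top (hG : #G ≤ aleph 1) (hH : H.IsAbsConvex)
    (hH' : H'.IsAbsConvex) (h1 : (1 : G) ∈ H) (h1' : (1 : G) ∈ H') {x x' : G}
    (hx : x ∈ H) (hx' : x' ∈ H') (hinf : ∀ n : ℕ, (n : G) < x) (hinf' : ∀ n : ℕ, (n : G) < x')
    (hd : ∀ n : ℕ, 0 < n → (n : G) ∣ x) (hd' : ∀ n : ℕ, 0 < n → (n : G) ∣ x')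
    (htop : ∀ b ∈ H, ∃ n : ℕ, b ≤ n * x) (htop' : ∀ b ∈ H', ∃ n : ℕ, b ≤ n * x') :
    ∃ R, IsIsoGraph H H' R := by
  have h0 := IsPartialIso.diagonal h1 h1'
  have h := h0.pureHull_of_lt hH hH' hx hx' (by
    rintro _ _ ⟨n, hn⟩
    simp only [Prod.mk.injEq] at hn
    rw [← hn.1, ← hn.2]
    exact ⟨intCast_lt_of_natCast_lt hinf n, intCast_lt_of_natCast_lt hinf' n⟩) hd hd'
  refine h.exists_isIsoGraph_of_cofinal hG hH hH' (fun b hb => ?_) (fun b hb => ?_)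
  · obtain ⟨n, hn⟩ := htop b hb
    exact ⟨_, h.natCast_mul_mem (h0.mem_pureHull x x') n, hn⟩
  · obtain ⟨n, hn⟩ := htop' b hb
    exact ⟨_, h.natCast_mul_mem (h0.mem_pureHull x x') n, hn⟩

/-- The pure hull of the standard integers and the first `n` terms of two sequences. -/
def iteratedPureHull (x x' : ℕ → G) : ℕ → Set (G × G)
  | 0 => Set.range fun n : ℤ => ((n : G), (n : G))
  | n + 1 => pureHull (iteratedPureHull x x' n) (x n) (x' n)

/-- Each new pair lies above everything generated so far, so it may be adjoined freely; the union
over all stages is cofinal on both sides. -/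
theorem exists_isIsoGraph_of_sequence (hG : #G ≤ aleph 1) (hH : H.IsAbsConvex)
    (hH' : H'.IsAbsConvex) (h1 : (1 : G) ∈ H) (h1' : (1 : G) ∈ H') {x x' : ℕ → G}
    (hx : ∀ i, x i ∈ H) (hx' : ∀ i, x' i ∈ H')
    (hinf : ∀ n : ℕ, (n : G) < x 0) (hinf' : ∀ n : ℕ, (n : G) < x' 0)
    (hd : ∀ i, ∀ n : ℕ, 0 < n → (n : G) ∣ x i) (hd' : ∀ i, ∀ n : ℕ, 0 < n → (n : G) ∣ x' i)
    (hs : ∀ i, ∀ n : ℕ, n * x i < x (i + 1)) (hs' : ∀ i, ∀ n : ℕ, n * x' i < x' (i + 1))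
    (hcof : ∀ b ∈ H, ∃ i, b ≤ x i) (hcof' : ∀ b ∈ H', ∃ i, b ≤ x' i) :
    ∃ R, IsIsoGraph H H' R := by
  have hpos : ∀ i, 0 < x i := by
    rintro (_ | i)
    · simpa using hinf 0
    · simpa using hs i 0
  have hpos' : ∀ i, 0 < x' i := by
    rintro (_ | i)
    · simpa using hinf' 0
    · simpa using hs' i 0
  have key : ∀ n, IsPartialIso H H' (iteratedPureHull x x' n) ∧
      ∀ p q, (p, q) ∈ iteratedPureHull x x' n → p < x n ∧ q < x' n := by
    intro n
    induction n with
    | zero =>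
      refine ⟨IsPartialIso.diagonal h1 h1', ?_⟩
      rintro _ _ ⟨n, hn⟩
      simp only [Prod.mk.injEq] at hn
      rw [← hn.1, ← hn.2]
      exact ⟨intCast_lt_of_natCast_lt hinf n, intCast_lt_of_natCast_lt hinf' n⟩
    | succ n ih =>
      refine ⟨ih.1.pureHull_of_lt hH hH' (hx n) (hx' n) ih.2 (hd n) (hd' n), ?_⟩
      rintro p q ⟨m, hm, j, hpq⟩
      obtain ⟨h2, h3⟩ := ih.2 _ _ hpq
      exact ⟨lt_of_mul_sub_mul_lt hm (hpos n) h2 (hs n), lt_of_mul_sub_mul_lt hm (hpos' n) h3 (hs' n)⟩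
  have hmono : Monotone (iteratedPureHull x x') :=
    monotone_nat_of_le_succ fun n => IsPartialIso.subset_pureHull _ _ _
  have h := IsPartialIso.sUnion (Set.countable_range (iteratedPureHull x x'))
    (Set.range_nonempty _) hmono.isChain_range (by
      rintro _ ⟨n, rfl⟩
      exact (key n).1)
  have hmem : ∀ n, (x n, x' n) ∈ ⋃₀ Set.range (iteratedPureHull x x') := fun n =>
    ⟨_, ⟨n + 1, rfl⟩, (key n).1.mem_pureHull _ _⟩
  refine h.exists_isIsoGraph_of_cofinal hG hH hH' (fun b hb => ?_) (fun b hb => ?_)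
  · obtain ⟨i, hi⟩ := hcof b hb
    exact ⟨_, hmem i, hi⟩
  · obtain ⟨i, hi⟩ := hcof' b hb
    exact ⟨_, hmem i, hi⟩

end PartialIso

/-! ### Saturation of the ultrapower of the integers -/

open Filter in
/-- Countable saturation of ultrapowers by nonprincipal ultrafilters on countable sets. -/
theorem Ultrafilter.exists_forall_eventually {I β : Type*} [Countable I] {D : Ultrafilter I}
    (hD : ∀ i : I, D ≠ pure i) {p : ℕ → I → β → Prop}
    (h : ∀ n, ∀ᶠ i in (D : Filter I), ∃ z, ∀ k < n, p k i z) :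
    ∃ f : I → β, ∀ k, ∀ᶠ i in (D : Filter I), p k i (f i) := by
  classical
  obtain ⟨e, he⟩ := exists_injective_nat I
  have hcof : (D : Filter I) ≤ cofinite :=
    D.le_cofinite_or_eq_pure.resolve_right fun ⟨i, hi⟩ => hD i hi
  -- At `i`, satisfy as many initial conditions as possible, but at most `e i`. The cap ensures that
  -- a maximum exists, and it exceeds any given number for almost all `i`, as `e` is injective and
  -- `D` nonprincipal.
  let N : I → ℕ := fun i => Nat.findGreatest (fun n => ∃ z, ∀ k < n, p k i z) (e i)
  obtain ⟨-, z₀, -⟩ := (h 0).exists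
  have hN : ∀ i, ∃ z, ∀ k < N i, p k i z := fun i =>
    Nat.findGreatest_spec (P := fun n => ∃ z, ∀ k < n, p k i z) (Nat.zero_le (e i))
      ⟨z₀, fun k hk => (Nat.not_lt_zero k hk).elim⟩
  choose f hf using hN
  refine ⟨f, fun k => ?_⟩
  have hlarge : ∀ᶠ i in (D : Filter I), k + 1 ≤ e i := by
    apply hcof
    rw [mem_cofinite]
    refine ((Set.finite_lt_nat (k + 1)).preimage he.injOn).subset fun i hi => ?_
    simpa using hi
  filter_upwards [h (k + 1), hlarge] with i h1 h2
  exact hf i k (Nat.le_findGreatest h2 h1)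

/-- The `n!` integers following the largest `l j` include one congruent to `b` modulo `n!`, hence
modulo each of `1, …, n`; the assumed gap leaves room for them. -/
theorem Int.exists_between_dvd {n : ℕ} {l u : ℕ → ℤ} (b : ℤ)
    (h : ∀ j < n, ∀ k < n, l j + (n.factorial + 1 : ℕ) < u k) :
    ∃ z, ∀ k < n, l k < z ∧ z < u k ∧ ((k + 1 : ℕ) : ℤ) ∣ b - z := by
  rcases n.eq_zero_or_pos with rfl | hn
  · exact ⟨0, fun k hk => (Nat.not_lt_zero k hk).elim⟩
  obtain ⟨j, hj, hmax⟩ := Finset.exists_max_image (Finset.range n) l ⟨0, by simpa using hn⟩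
  simp only [Finset.mem_range] at hj hmax
  have hpos : (0 : ℤ) < n.factorial := by exact_mod_cast n.factorial_pos
  have h1 := Int.emod_nonneg (b - l j - 1) hpos.ne'
  have h2 := Int.emod_lt_of_pos (b - l j - 1) hpos
  refine ⟨l j + 1 + (b - l j - 1) % n.factorial, fun k hk => ⟨?_, ?_, ?_⟩⟩
  · have := hmax k hk
    omega
  · have := h j hj k hk
    push_cast at this
    omega
  · have h3 : ((k + 1 : ℕ) : ℤ) ∣ n.factorial := by
      exact_mod_cast Nat.dvd_factorial k.succ_pos hk
    have h4 := Int.emod_add_mul_ediv (b - l j - 1) n.factorial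
    have h5 : b - (l j + 1 + (b - l j - 1) % n.factorial) =
        n.factorial * ((b - l j - 1) / n.factorial) := by linarith
    rw [h5]
    exact h3.mul_right _

namespace Filter.Germ

variable {I : Type u} {D : Ultrafilter I}

theorem natCast_eq_coe (n : ℕ) : (n : (D : Filter I).Germ ℤ) = ((fun _ => (n : ℤ) : I → ℤ)) := rfl

theorem natCast_dvd_coe {n : ℕ} {f : I → ℤ} (h : ∀ᶠ i in (D : Filter I), (n : ℤ) ∣ f i) :
    (n : (D : Filter I).Germ ℤ) ∣ (f : (D : Filter I).Germ ℤ) := by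
  refine ⟨((fun i => f i / n : I → ℤ) : (D : Filter I).Germ ℤ), ?_⟩
  rw [natCast_eq_coe, ← Germ.coe_mul, Germ.coe_eq]
  filter_upwards [h] with i hi
  exact (Int.mul_ediv_cancel' hi).symm

theorem saturatedIntegers [Countable I] (hD : ∀ i : I, D ≠ pure i) :
    SaturatedIntegers ((D : Filter I).Germ ℤ) where
  one_le_of_pos x := by
    induction x using Germ.inductionOn with
    | _ f =>
    intro h
    have h' : ∀ᶠ i in (D : Filter I), 0 < f i := Germ.coe_pos.1 h
    change ((fun _ => 1 : I → ℤ) : (D : Filter I).Germ ℤ) ≤ f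
    rw [Germ.coe_le]
    exact h'.mono fun i hi => hi
  exists_rem x n hn := by
    induction x using Germ.inductionOn with
    | _ f =>
    have hn' : (0 : ℤ) < n := by exact_mod_cast hn
    let g : I → Fin n := fun i => ⟨(f i % n).toNat, by
      have h1 := Int.emod_nonneg (f i) hn'.ne'
      have h2 := Int.emod_lt_of_pos (f i) hn'
      omega⟩
    -- The residue takes finitely many values, so it is constant on a set in `D`.
    obtain ⟨r, hr⟩ := (D.map g).eq_pure_of_finite
    have hr' : ∀ᶠ i in (D : Filter I), g i = r := by
      have : ({r} : Set (Fin n)) ∈ D.map g := by rw [hr]; exact Ultrafilter.mem_pure.2 rfl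
      exact this
    refine ⟨r, r.2, ?_⟩
    rw [natCast_eq_coe r, ← Germ.coe_sub]
    apply natCast_dvd_coe
    filter_upwards [hr'] with i hi
    have h1 := Int.emod_nonneg (f i) hn'.ne'
    have h2 : (f i % n).toNat = r := congrArg Fin.val hi
    have h3 : ((r : ℕ) : ℤ) = f i % n := by omega
    simp only [Pi.sub_apply, h3]
    exact Int.dvd_self_sub_emod
  exists_between L U hL hU hLne hUne hgap b := by
    obtain ⟨l, rfl⟩ := hL.exists_eq_range hLne
    obtain ⟨u, rfl⟩ := hU.exists_eq_range hUne
    have hrep : ∀ x : (D : Filter I).Germ ℤ, ∃ f : I → ℤ, x = f := fun x =>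
      Germ.inductionOn x fun f => ⟨f, rfl⟩
    choose lf hlf using fun k => hrep (l k)
    choose uf huf using fun k => hrep (u k)
    obtain ⟨bf, rfl⟩ := hrep b
    obtain ⟨f, hf⟩ := Ultrafilter.exists_forall_eventually hD
      (p := fun k i z => lf k i < z ∧ z < uf k i ∧ ((k + 1 : ℕ) : ℤ) ∣ bf i - z) (by
        intro n
        have : ∀ᶠ i in (D : Filter I), ∀ j ∈ Set.Iio n, ∀ k ∈ Set.Iio n,
            lf j i + (n.factorial + 1 : ℕ) < uf k i := by
          rw [eventually_all_finite (Set.finite_Iio n)]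
          intro j _
          rw [eventually_all_finite (Set.finite_Iio n)]
          intro k _
          have := hgap _ ⟨j, rfl⟩ _ ⟨k, rfl⟩ (n.factorial + 1)
          rwa [hlf, huf, natCast_eq_coe, ← Germ.coe_add, Germ.coe_lt] at this
        filter_upwards [this] with i hi
        exact Int.exists_between_dvd (bf i) (l := fun k => lf k i) (u := fun k => uf k i) hi)
    refine ⟨(f : (D : Filter I).Germ ℤ), ?_, ?_, ?_⟩
    · rintro _ ⟨k, rfl⟩
      rw [hlf, Germ.coe_lt]
      exact (hf k).mono fun i hi => hi.1
    · rintro _ ⟨k, rfl⟩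
      rw [huf, Germ.coe_lt]
      exact (hf k).mono fun i hi => hi.2.1
    · intro n hn
      obtain ⟨k, rfl⟩ := Nat.exists_eq_succ_of_ne_zero hn.ne'
      rw [← Germ.coe_sub]
      exact natCast_dvd_coe ((hf k).mono fun i hi => hi.2.2)

/-! ### From natural numbers to integers -/

variable (D) in
/-- The embedding of the ultrapower of the natural numbers in that of the integers. -/
def natToInt : NatUltrapower D →+ (D : Filter I).Germ ℤ where
  toFun := Germ.map (Nat.cast : ℕ → ℤ)
  map_zero' := rfl
  map_add' x y := Germ.inductionOn₂ x y fun f g => by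
    rw [← Germ.coe_add, Germ.map_coe, Germ.map_coe, Germ.map_coe, ← Germ.coe_add]
    congr 1

theorem natToInt_le {x y : NatUltrapower D} : natToInt D x ≤ natToInt D y ↔ x ≤ y :=
  Germ.inductionOn₂ x y fun f g => by
    change ((((Nat.cast : ℕ → ℤ) ∘ f : I → ℤ) : (D : Filter I).Germ ℤ) ≤
      (((Nat.cast : ℕ → ℤ) ∘ g : I → ℤ) : (D : Filter I).Germ ℤ)) ↔ _
    rw [Germ.coe_le, Germ.coe_le]
    exact eventually_congr (Eventually.of_forall fun i => Int.ofNat_le)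

theorem natToInt_lt {x y : NatUltrapower D} : natToInt D x < natToInt D y ↔ x < y := by
  rw [← not_le, ← not_le, natToInt_le]

theorem natToInt_natCast (n : ℕ) : natToInt D (n : NatUltrapower D) = n := rfl

theorem natToInt_nsmul (n : ℕ) (x : NatUltrapower D) : natToInt D (n • x) = n * natToInt D x := by
  rw [map_nsmul, nsmul_eq_mul]

theorem natToInt_nonneg (x : NatUltrapower D) : 0 ≤ natToInt D x := by
  rw [← map_zero (natToInt D), natToInt_le]
  exact zero_le

theorem exists_natToInt_eq {x : (D : Filter I).Germ ℤ} (hx : 0 ≤ x) :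
    ∃ a, natToInt D a = x := by
  induction x using Germ.inductionOn with
  | _ f =>
  have h' : ∀ᶠ i in (D : Filter I), 0 ≤ f i := Germ.coe_nonneg.1 hx
  refine ⟨((fun i => (f i).toNat : I → ℕ) : (D : Filter I).Germ ℕ), ?_⟩
  refine Germ.coe_eq.2 ?_
  filter_upwards [h'] with i hi
  exact Int.toNat_of_nonneg hi

end Filter.Germ
open Filter.Germ

/-! ### Convex subsemigroups and their top classes -/

namespace ConvexSubsemigroup

variable {I : Type u} {D : Ultrafilter I}

theorem mem_of_le (Δ : ConvexSubsemigroup D) {a b : NatUltrapower D} (h : a ≤ b)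
    (hb : b ∈ Δ.toAddSubmonoid) : a ∈ Δ.toAddSubmonoid :=
  Δ.ordConnected'.out Δ.toAddSubmonoid.zero_mem hb ⟨zero_le, h⟩

/-- A submonoid that is an initial segment, as a convex subsemigroup. -/
def ofIsLowerSet (S : AddSubmonoid (NatUltrapower D)) (h : IsLowerSet (S : Set (NatUltrapower D))) :
    ConvexSubsemigroup D where
  toAddSubmonoid := S
  ordConnected' := h.ordConnected

theorem add_one_le_of_lt {x y : NatUltrapower D} (h : x < y) : x + 1 ≤ y := by
  induction x using Filter.Germ.inductionOn with
  | _ f =>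
  induction y using Filter.Germ.inductionOn with
  | _ g =>
  have h' : ∀ᶠ i in (D : Filter I), f i < g i := coe_lt.1 h
  change (((f + fun _ => 1 : I → ℕ)) : (D : Filter I).Germ ℕ) ≤ g
  rw [coe_le]
  exact h'.mono fun i hi => hi

theorem one_le_of_ne_zero {x : NatUltrapower D} (h : x ≠ 0) : 1 ≤ x := by
  simpa using add_one_le_of_lt ((zero_le (a := x)).lt_of_ne h.symm)

theorem one_mem_of_ne_bot {Δ : ConvexSubsemigroup D} (h : Δ.toAddSubmonoid ≠ ⊥) :
    1 ∈ Δ.toAddSubmonoid := by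
  obtain ⟨x, hx, hx0⟩ := (AddSubmonoid.bot_or_exists_ne_zero Δ.toAddSubmonoid).resolve_left h
  exact Δ.mem_of_le (one_le_of_ne_zero hx0) hx

theorem hasTopClass_iff {Δ : ConvexSubsemigroup D} :
    Δ.HasTopClass ↔ ∃ a : Δ, a ≠ 0 ∧ ∀ b : Δ, ∃ n : ℕ, b ≤ n • a := by
  constructor
  · rintro ⟨c, hc⟩
    induction c using Antisymmetrization.ind with
    | _ a =>
    refine ⟨a.val, a.ne_zero, fun b => ?_⟩
    by_cases hb : b = 0
    · exact ⟨0, by simp [hb]⟩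
    · exact toAntisymmetrization_le_toAntisymmetrization_iff.1
        (hc (toAntisymmetrization _ (⟨b, hb⟩ : ArchimedeanPreorder Δ)))
  · rintro ⟨a, ha, h⟩
    refine ⟨toAntisymmetrization _ ⟨a, ha⟩, fun c => ?_⟩
    induction c using Antisymmetrization.ind with
    | _ b => exact toAntisymmetrization_le_toAntisymmetrization_iff.2 (h b.val)

theorem HasTopClass.of_equiv {Δ Δ' : ConvexSubsemigroup D} (e : Δ ≃+o Δ') (h : Δ.HasTopClass) :
    Δ'.HasTopClass := by
  rw [hasTopClass_iff] at h ⊢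
  obtain ⟨a, ha, h⟩ := h
  refine ⟨e a, fun h0 => ha (e.toAddEquiv.map_eq_zero_iff.1 h0), fun b => ?_⟩
  obtain ⟨n, hn⟩ := h (e.symm b)
  refine ⟨n, ?_⟩
  have := OrderHomClass.mono e hn
  rwa [map_nsmul, OrderAddMonoidIso.apply_symm_apply] at this

/-! ### The convex subgroup of the ultrapower of the integers -/

/-- The convex subgroup of `∏_D ℤ` generated by `Δ`. -/
def hull (Δ : ConvexSubsemigroup D) : AddSubgroup ((D : Filter I).Germ ℤ) where
  carrier := {x | ∃ a ∈ Δ.toAddSubmonoid, |x| ≤ natToInt D a}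
  zero_mem' := ⟨0, Δ.toAddSubmonoid.zero_mem, by simp⟩
  add_mem' := by
    rintro x y ⟨a, ha, hx⟩ ⟨b, hb, hy⟩
    exact ⟨a + b, Δ.toAddSubmonoid.add_mem ha hb,
      (abs_add_le x y).trans (by rw [map_add]; exact add_le_add hx hy)⟩
  neg_mem' := by
    rintro x ⟨a, ha, hx⟩
    exact ⟨a, ha, by rwa [abs_neg]⟩

variable {Δ Δ' : ConvexSubsemigroup D}

theorem hull_isAbsConvex (Δ : ConvexSubsemigroup D) : Δ.hull.IsAbsConvex := by
  rintro x ⟨a, ha, hx⟩ y hy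
  exact ⟨a, ha, hy.trans hx⟩

theorem natToInt_mem_hull {a : NatUltrapower D} : natToInt D a ∈ Δ.hull ↔ a ∈ Δ.toAddSubmonoid := by
  constructor
  · rintro ⟨b, hb, h⟩
    rw [abs_of_nonneg (natToInt_nonneg a), natToInt_le] at h
    exact Δ.mem_of_le h hb
  · intro h
    exact ⟨a, h, (abs_of_nonneg (natToInt_nonneg a)).le⟩

theorem one_mem_hull (h : Δ.toAddSubmonoid ≠ ⊥) : 1 ∈ Δ.hull := by
  have := natToInt_mem_hull.2 (one_mem_of_ne_bot h)
  rwa [← Nat.cast_one, natToInt_natCast, Nat.cast_one] at this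

theorem exists_mem_graph {R : Set ((D : Filter I).Germ ℤ × (D : Filter I).Germ ℤ)}
    (h : IsIsoGraph Δ.hull Δ'.hull R) (a : Δ) : ∃ a' : Δ', (natToInt D a, natToInt D a') ∈ R := by
  obtain ⟨y, hy⟩ := h.left_total _ (natToInt_mem_hull.2 a.2) (natToInt_nonneg _)
  obtain ⟨b, rfl⟩ := exists_natToInt_eq ((h.nonneg_iff _ _ hy).1 (natToInt_nonneg _))
  exact ⟨⟨b, natToInt_mem_hull.1 (h.mem _ _ hy).2⟩, hy⟩

/-- Preservation of the sign of differences makes `R` single-valued and injective on the nonnegative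
part, so choices made in the two directions are inverse to each other. -/
theorem Iso.of_isIsoGraph {R : Set ((D : Filter I).Germ ℤ × (D : Filter I).Germ ℤ)}
    (h : IsIsoGraph Δ.hull Δ'.hull R) : Δ.Iso Δ' := by
  choose f hf using exists_mem_graph h
  choose g hg using exists_mem_graph h.swap
  have hle : ∀ {a b : Δ} {a' b' : Δ'}, (natToInt D a, natToInt D a') ∈ R →
      (natToInt D b, natToInt D b') ∈ R → (a' ≤ b' ↔ a ≤ b) := by
    intro a b a' b' ha hb
    have := h.nonneg_iff _ _ (h.sub_mem _ _ _ _ hb ha)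
    rw [sub_nonneg, sub_nonneg, natToInt_le, natToInt_le] at this
    exact this.symm
  have hadd : ∀ {a b : Δ} {a' b' : Δ'}, (natToInt D a, natToInt D a') ∈ R →
      (natToInt D b, natToInt D b') ∈ R →
      (natToInt D (a + b : Δ), natToInt D (a' + b' : Δ')) ∈ R := by
    intro a b a' b' ha hb
    have h0 := h.sub_mem _ _ _ _ hb hb
    -- The graph is closed under differences, so the sum is obtained as `a - ((b - b) - b)`.
    have := h.sub_mem _ _ _ _ ha (h.sub_mem _ _ _ _ h0 hb)
    simpa using this
  have hunique : ∀ {a : Δ} {a' b' : Δ'}, (natToInt D a, natToInt D a') ∈ R →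
      (natToInt D a, natToInt D b') ∈ R → a' = b' := fun h1 h2 =>
    le_antisymm ((hle h1 h2).2 le_rfl) ((hle h2 h1).2 le_rfl)
  have hunique' : ∀ {a b : Δ} {a' : Δ'}, (natToInt D a, natToInt D a') ∈ R →
      (natToInt D b, natToInt D a') ∈ R → a = b := fun h1 h2 =>
    le_antisymm ((hle h1 h2).1 le_rfl) ((hle h2 h1).1 le_rfl)
  exact ⟨{
    toFun := f
    invFun := g
    left_inv := fun a => hunique' (hg (f a)) (hf a)
    right_inv := fun a => hunique (hf (g a)) (hg a)
    map_add' := fun a b => hunique (hf (a + b)) (hadd (hf a) (hf b))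
    map_le_map_iff' := fun {a b} => hle (hf a) (hf b) }⟩

/-! ### Cofinality -/

/-- The germs are a quotient of `I → β`, of size at most `ℵ₀ ^ ℵ₀`, the continuum; CH is lifted from
universe `0`. -/
theorem mk_germ_le (hCH : continuum.{0} = aleph.{0} 1) [Countable I] {β : Type} [Countable β] :
    #((D : Filter I).Germ β) ≤ aleph 1 := by
  have h1 : #((D : Filter I).Germ β) ≤ #(I → β) := Cardinal.mk_quotient_le
  refine h1.trans ?_
  have h2 : #(I → β) ≤ ℵ₀ ^ ℵ₀ := by
    rw [Cardinal.mk_arrow, Cardinal.lift_uzero]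
    refine (Cardinal.power_le_power_right (Cardinal.lift_le_aleph0.2 Cardinal.mk_le_aleph0)).trans ?_
    exact Cardinal.power_le_power_left Cardinal.aleph0_ne_zero Cardinal.mk_le_aleph0
  rw [Cardinal.aleph0_power_aleph0] at h2
  have h3 := congrArg Cardinal.lift.{u} hCH
  rw [Cardinal.lift_continuum, Cardinal.lift_aleph] at h3
  rw [h3] at h2
  simpa using h2

theorem noTopOrder (h : Δ.toAddSubmonoid ≠ ⊥) : NoTopOrder Δ where
  exists_not_le a := by
    refine ⟨a + ⟨1, one_mem_of_ne_bot h⟩, fun h1 => ?_⟩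
    have h2 : (a : NatUltrapower D) + 1 ≤ a := h1
    have h3 : (0 : NatUltrapower D) < 1 := one_pos
    exact absurd h2 (not_le_of_gt (lt_add_of_pos_right _ h3))

theorem cof_eq_aleph0_or_aleph1 (hCH : continuum.{0} = aleph.{0} 1) [Countable I]
    (h : Δ.toAddSubmonoid ≠ ⊥) : Order.cof Δ = ℵ₀ ∨ Order.cof Δ = aleph 1 := by
  have := noTopOrder h
  have h1 : ℵ₀ ≤ Order.cof Δ := Order.aleph0_le_cof_iff.2 Order.one_lt_cof
  have h2 : Order.cof Δ ≤ aleph 1 :=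
    (Order.cof_le_cardinalMk _).trans ((mk_subtype_le _).trans (mk_germ_le hCH))
  rcases h1.eq_or_lt with h3 | h3
  · exact Or.inl h3.symm
  · refine Or.inr (h2.antisymm ?_)
    rw [← Cardinal.succ_aleph0]
    exact Order.succ_le_of_lt h3

theorem cof_of_eq_bot (h : Δ.toAddSubmonoid = ⊥) : Order.cof Δ = 1 := by
  refine Order.cof_eq_one_iff.2 ⟨0, fun x => ?_⟩
  have h0 : ∀ y ∈ Δ.toAddSubmonoid, y = 0 := fun y hy => by rwa [h, AddSubmonoid.mem_bot] at hy
  exact (h0 x x.2).le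

theorem exists_lt_of_cof_eq_aleph1 (h : Order.cof Δ = aleph 1)
    {C : Set ((D : Filter I).Germ ℤ)} (hC : C.Countable) (hCΔ : C ⊆ Δ.hull) :
    ∃ d ∈ Δ.hull, ∀ c ∈ C, c < d := by
  have hCΔ' : ∀ c ∈ C, ∃ a ∈ Δ.toAddSubmonoid, |c| ≤ natToInt D a := fun c hc => hCΔ hc
  choose! a ha hle using hCΔ'
  have := hC.to_subtype
  let S : Set Δ := Set.range fun c : C => ⟨a c, ha c c.2⟩
  have hS : ¬ IsCofinal S := fun hS => by
    have h1 := Order.cof_le hS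
    rw [h, ← not_lt, Cardinal.lt_aleph_one_iff, Cardinal.mk_le_aleph0_iff] at h1
    exact h1 (Set.countable_range _).to_subtype
  obtain ⟨x, hx⟩ := not_isCofinal_iff.1 hS
  refine ⟨natToInt D x, natToInt_mem_hull.2 x.2, fun c hc => ?_⟩
  exact ((le_abs_self c).trans (hle c hc)).trans_lt (natToInt_lt.2 (hx _ ⟨⟨c, hc⟩, rfl⟩))

theorem exists_cofinal_sequence (h : Order.cof Δ = ℵ₀) :
    ∃ s : ℕ → Δ, ∀ b, ∃ i, b ≤ s i := by
  obtain ⟨S, hS, hS'⟩ := Order.exists_cof_eq Δ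
  rw [h] at hS'
  have hc : S.Countable := Cardinal.mk_le_aleph0_iff.1 hS'.le
  obtain ⟨s, rfl⟩ := hc.exists_eq_range hS.nonempty
  refine ⟨s, fun b => ?_⟩
  obtain ⟨_, ⟨i, rfl⟩, hi⟩ := hS b
  exact ⟨i, hi⟩

theorem cof_eq_aleph0_of_sequence (h : Δ.toAddSubmonoid ≠ ⊥) (s : ℕ → Δ)
    (hs : ∀ b, ∃ i, b ≤ s i) : Order.cof Δ = ℵ₀ := by
  have := noTopOrder h
  refine le_antisymm ((Order.cof_le (s := Set.range s) fun b => ?_).trans ?_)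
    (Order.aleph0_le_cof_iff.2 Order.one_lt_cof)
  · obtain ⟨i, hi⟩ := hs b
    exact ⟨_, ⟨i, rfl⟩, hi⟩
  · exact Cardinal.mk_le_aleph0_iff.2 (Set.countable_range s).to_subtype

/-! ### Isomorphisms between convex subsemigroups of the same kind -/

/-- The gap between `x` and `2 * x` is infinite, so saturation applies with the residues of `0`. -/
theorem exists_dvd_between [SaturatedIntegers ((D : Filter I).Germ ℤ)]
    {x : (D : Filter I).Germ ℤ} (hx : ∀ n : ℕ, (n : (D : Filter I).Germ ℤ) < x) :
    ∃ z, x < z ∧ z < 2 * x ∧ ∀ n : ℕ, 0 < n → (n : (D : Filter I).Germ ℤ) ∣ z := by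
  obtain ⟨z, h1, h2, h3⟩ := SaturatedIntegers.exists_between {x} {2 * x} (Set.countable_singleton _)
    (Set.countable_singleton _) (Set.singleton_nonempty _) (Set.singleton_nonempty _) (by
      rintro _ rfl _ rfl n
      have := hx n
      linarith) 0
  refine ⟨z, h1 x rfl, h2 _ rfl, fun n hn => ?_⟩
  simpa using h3 n hn

theorem exists_dvd_between_mem [SaturatedIntegers ((D : Filter I).Germ ℤ)]
    {x : (D : Filter I).Germ ℤ} (hx : ∀ n : ℕ, (n : (D : Filter I).Germ ℤ) < x) (hxΔ : x ∈ Δ.hull) :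
    ∃ z ∈ Δ.hull, x < z ∧ ∀ n : ℕ, 0 < n → (n : (D : Filter I).Germ ℤ) ∣ z := by
  obtain ⟨z, h1, h2, h3⟩ := exists_dvd_between hx
  have h0 : 0 < x := by simpa using hx 0
  refine ⟨z, Δ.hull_isAbsConvex _ (Δ.hull.add_mem hxΔ hxΔ) z ?_, h1, h3⟩
  exact abs_le_abs_of_nonneg (h0.trans h1).le (by linarith)

theorem exists_top_of_hasTopClass [SaturatedIntegers ((D : Filter I).Germ ℤ)]
    (h : Δ.HasTopClass) (hn : Δ.Nonstandard) :
    ∃ x ∈ Δ.hull, (∀ n : ℕ, (n : (D : Filter I).Germ ℤ) < x) ∧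
      (∀ n : ℕ, 0 < n → (n : (D : Filter I).Germ ℤ) ∣ x) ∧ ∀ b ∈ Δ.hull, ∃ n : ℕ, b ≤ n * x := by
  obtain ⟨a, -, ha⟩ := hasTopClass_iff.1 h
  obtain ⟨w, hw, hinf⟩ := hn
  -- In `w + a`, the summand `w` makes the element infinite and `a` makes its multiples cofinal.
  have hinf' : ∀ n : ℕ, (n : (D : Filter I).Germ ℤ) < natToInt D (w + a) := fun n => by
    rw [← natToInt_natCast, natToInt_lt]
    exact (hinf n).trans_le (le_add_of_nonneg_right zero_le)
  obtain ⟨x, hx, hlt, hdvd⟩ := exists_dvd_between_mem (Δ := Δ) hinf'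
    (natToInt_mem_hull.2 (Δ.toAddSubmonoid.add_mem hw a.2))
  refine ⟨x, hx, fun n => (hinf' n).trans hlt, hdvd, ?_⟩
  rintro b ⟨c, hc, hb⟩
  obtain ⟨n, hn⟩ := ha ⟨c, hc⟩
  refine ⟨n, (le_abs_self b).trans (hb.trans ?_)⟩
  have h1 : natToInt D c ≤ natToInt D (n • (a : NatUltrapower D)) := natToInt_le.2 hn
  rw [natToInt_nsmul] at h1
  refine h1.trans (mul_le_mul_of_nonneg_left ?_ n.cast_nonneg)
  exact (natToInt_le.2 (le_add_of_nonneg_left zero_le)).trans hlt.le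

theorem exists_sequence_of_not_hasTopClass [SaturatedIntegers ((D : Filter I).Germ ℤ)]
    (h0 : Δ.toAddSubmonoid ≠ ⊥) (hcof : Order.cof Δ = ℵ₀) (h : ¬ Δ.HasTopClass) :
    ∃ x : ℕ → (D : Filter I).Germ ℤ, (∀ i, x i ∈ Δ.hull) ∧
      (∀ n : ℕ, (n : (D : Filter I).Germ ℤ) < x 0) ∧
      (∀ i, ∀ n : ℕ, 0 < n → (n : (D : Filter I).Germ ℤ) ∣ x i) ∧
      (∀ i, ∀ n : ℕ, n * x i < x (i + 1)) ∧ ∀ b ∈ Δ.hull, ∃ i, b ≤ x i := by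
  obtain ⟨s, hs⟩ := exists_cofinal_sequence hcof
  have hone := one_mem_of_ne_bot h0
  have step : ∀ i : ℕ, ∀ x ∈ Δ.hull, ∃ z ∈ Δ.hull, (∀ n : ℕ, n * x < z) ∧
      (∀ n : ℕ, (n : (D : Filter I).Germ ℤ) < z) ∧ natToInt D (s i) ≤ z ∧
      ∀ n : ℕ, 0 < n → (n : (D : Filter I).Germ ℤ) ∣ z := by
    rintro i x ⟨a, ha, hx⟩
    -- One element dominating `x`, `s i` and `1`. Without a top class, some `b` exceeds all its
    -- multiples, and `z` is taken above `b`.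
    let w : Δ := ⟨a, ha⟩ + s i + ⟨1, hone⟩
    have hw : (w : NatUltrapower D) = a + s i + 1 := rfl
    have hw0 : w ≠ 0 := fun hw0 => by
      have h1 : (1 : NatUltrapower D) ≤ 0 :=
        calc (1 : NatUltrapower D) ≤ a + s i + 1 := le_add_of_nonneg_left zero_le
          _ = 0 := hw.symm.trans (congrArg Subtype.val hw0)
      exact absurd h1 (not_le_of_gt one_pos)
    rw [hasTopClass_iff] at h
    push Not at h
    obtain ⟨b, hb⟩ := h w hw0
    have hb' : ∀ n : ℕ, n * natToInt D w < natToInt D b := fun n => by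
      rw [← natToInt_nsmul]
      exact natToInt_lt.2 (hb n)
    have haw : natToInt D a ≤ natToInt D w := natToInt_le.2 (by
      rw [hw, add_assoc]; exact le_add_of_nonneg_right zero_le)
    have hsw : natToInt D (s i) ≤ natToInt D w := natToInt_le.2 (by
      rw [hw, add_right_comm]; exact le_add_of_nonneg_left zero_le)
    have h1w : 1 ≤ natToInt D w := by
      have : natToInt D ((1 : ℕ) : NatUltrapower D) ≤ natToInt D w := natToInt_le.2 (by
        rw [hw, Nat.cast_one]; exact le_add_of_nonneg_left zero_le)
      rwa [natToInt_natCast, Nat.cast_one] at this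
    have hinf : ∀ n : ℕ, (n : (D : Filter I).Germ ℤ) < natToInt D b := fun n =>
      (le_mul_of_one_le_right n.cast_nonneg h1w).trans_lt (hb' n)
    obtain ⟨z, hz, hlt, hdvd⟩ := exists_dvd_between_mem hinf (natToInt_mem_hull.2 b.2)
    refine ⟨z, hz, fun n => ?_, fun n => (hinf n).trans hlt, ?_, hdvd⟩
    · exact (mul_le_mul_of_nonneg_left ((le_abs_self x).trans (hx.trans haw))
        n.cast_nonneg).trans_lt ((hb' n).trans hlt)
    · have := hb' 1
      rw [Nat.cast_one, one_mul] at this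
      exact hsw.trans (this.trans hlt).le
  choose! F hF1 hF2 hF3 hF4 hF5 using step
  let x : ℕ → (D : Filter I).Germ ℤ := fun i => Nat.rec (F 0 0) (fun i y => F (i + 1) y) i
  have hx : ∀ i, x i ∈ Δ.hull ∧ ∃ y ∈ Δ.hull, x i = F i y := by
    intro i
    induction i with
    | zero => exact ⟨hF1 _ _ Δ.hull.zero_mem, 0, Δ.hull.zero_mem, rfl⟩
    | succ i ih => exact ⟨hF1 _ _ ih.1, x i, ih.1, rfl⟩
  refine ⟨x, fun i => (hx i).1, hF3 _ _ Δ.hull.zero_mem, fun i => ?_, fun i => ?_, ?_⟩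
  · obtain ⟨-, y, hy, h⟩ := hx i
    rw [h]
    exact hF5 _ _ hy
  · exact hF2 _ _ (hx i).1
  · rintro b ⟨a, ha, hb⟩
    obtain ⟨i, hi⟩ := hs ⟨a, ha⟩
    obtain ⟨-, y, hy, h⟩ := hx i
    refine ⟨i, (le_abs_self b).trans (hb.trans ?_)⟩
    rw [h]
    exact (natToInt_le.2 hi).trans (hF4 _ _ hy)

end ConvexSubsemigroup

namespace ConvexSubsemigroup

variable {I : Type u} {D : Ultrafilter I} {Δ Δ' : ConvexSubsemigroup D}

theorem ext_toAddSubmonoid (h : Δ.toAddSubmonoid = Δ'.toAddSubmonoid) : Δ = Δ' := by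
  cases Δ
  cases Δ'
  cases h
  rfl

/-! ### The standard copy of `ω` -/

theorem mem_standardCopy_of_le {n : ℕ} {x : NatUltrapower D} (h : x ≤ n) : x ∈ standardCopy D := by
  induction n with
  | zero => exact ⟨0, le_antisymm (by simp) h⟩
  | succ n ih =>
    rcases h.eq_or_lt with rfl | h
    · exact ⟨n + 1, rfl⟩
    · have h1 := add_one_le_of_lt h
      push_cast at h1
      exact ih (le_of_add_le_add_right h1)

theorem standardCopy_ne_bot : standardCopy D ≠ ⊥ := fun h => by
  have h1 : ((1 : ℕ) : NatUltrapower D) ∈ standardCopy D := ⟨1, rfl⟩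
  rw [h, AddSubmonoid.mem_bot, Nat.cast_one] at h1
  exact one_ne_zero h1

theorem eq_standardCopy_of_not_nonstandard (h0 : Δ.toAddSubmonoid ≠ ⊥) (h : ¬ Δ.Nonstandard) :
    Δ.toAddSubmonoid = standardCopy D := by
  apply le_antisymm
  · intro x hx
    have : ∃ n : ℕ, x ≤ n := by
      by_contra! hn
      exact h ⟨x, hx, hn⟩
    obtain ⟨n, hn⟩ := this
    exact mem_standardCopy_of_le hn
  · rintro _ ⟨n, rfl⟩
    have := Δ.toAddSubmonoid.nsmul_mem (one_mem_of_ne_bot h0) n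
    rwa [nsmul_one] at this

theorem ne_bot_of_eq_standardCopy (h : Δ.toAddSubmonoid = standardCopy D) :
    Δ.toAddSubmonoid ≠ ⊥ := h ▸ standardCopy_ne_bot

theorem le_nsmul_one_of_eq_standardCopy (h : Δ.toAddSubmonoid = standardCopy D) (b : Δ) :
    ∃ n : ℕ, b = n • ⟨1, one_mem_of_ne_bot (ne_bot_of_eq_standardCopy h)⟩ := by
  have h1 : ∀ x ∈ Δ.toAddSubmonoid, ∃ n : ℕ, (n : NatUltrapower D) = x := fun x hx => by
    rwa [h] at hx
  obtain ⟨n, hn⟩ := h1 b b.2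
  refine ⟨n, Subtype.ext ?_⟩
  rw [AddSubmonoidClass.coe_nsmul, nsmul_one, hn]

theorem cof_of_eq_standardCopy (h : Δ.toAddSubmonoid = standardCopy D) : Order.cof Δ = ℵ₀ :=
  cof_eq_aleph0_of_sequence (ne_bot_of_eq_standardCopy h)
    (fun n => n • ⟨1, one_mem_of_ne_bot (ne_bot_of_eq_standardCopy h)⟩)
    fun b => (le_nsmul_one_of_eq_standardCopy h b).imp fun _ hn => hn.le

theorem hasTopClass_of_eq_standardCopy (h : Δ.toAddSubmonoid = standardCopy D) : Δ.HasTopClass :=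
  hasTopClass_iff.2 ⟨⟨1, one_mem_of_ne_bot (ne_bot_of_eq_standardCopy h)⟩,
    fun h0 => one_ne_zero (congrArg Subtype.val h0),
    fun b => (le_nsmul_one_of_eq_standardCopy h b).imp fun _ hn => hn.le⟩

theorem not_nonstandard_of_eq_standardCopy (h : Δ.toAddSubmonoid = standardCopy D) :
    ¬ Δ.Nonstandard := by
  rintro ⟨x, hx, hlt⟩
  rw [h] at hx
  obtain ⟨n, rfl⟩ := hx
  exact (hlt n).false

/-! ### Every convex subsemigroup has exactly one kind -/

theorem exists_hasKind (hCH : continuum.{0} = aleph.{0} 1) [Countable I]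
    (Δ : ConvexSubsemigroup D) : ∃ k, Δ.HasKind k := by
  by_cases h0 : Δ.toAddSubmonoid = ⊥
  · exact ⟨0, h0⟩
  rcases cof_eq_aleph0_or_aleph1 hCH h0 with h | h
  · by_cases ht : Δ.HasTopClass
    · by_cases hn : Δ.Nonstandard
      · exact ⟨4, hn, h, ht⟩
      · exact ⟨1, eq_standardCopy_of_not_nonstandard h0 hn⟩
    · exact ⟨3, h, ht⟩
  · exact ⟨2, h⟩

theorem HasKind.unique {k k' : Fin 5} (h : Δ.HasKind k) (h' : Δ.HasKind k') : k = k' := by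
  have h01 : (1 : Cardinal.{u}) ≠ ℵ₀ := one_lt_aleph0.ne
  have h02 : (1 : Cardinal.{u}) ≠ aleph 1 := (one_lt_aleph0.trans_le (aleph0_le_aleph 1)).ne
  have h12 : (ℵ₀ : Cardinal.{u}) ≠ aleph 1 := aleph0_lt_aleph_one.ne
  -- Cofinality, top class and nonstandardness together separate the five kinds.
  have hcof : ∀ j : Fin 5, Δ.HasKind j →
      (j = 0 ∧ Order.cof Δ = 1) ∨ (j = 2 ∧ Order.cof Δ = aleph 1) ∨
      (j = 3 ∧ Order.cof Δ = ℵ₀ ∧ ¬ Δ.HasTopClass) ∨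
      (j = 1 ∧ Order.cof Δ = ℵ₀ ∧ Δ.HasTopClass ∧ ¬ Δ.Nonstandard) ∨
      (j = 4 ∧ Order.cof Δ = ℵ₀ ∧ Δ.HasTopClass ∧ Δ.Nonstandard) := by
    intro j hj
    match j, hj with
    | 0, hj => exact Or.inl ⟨rfl, cof_of_eq_bot hj⟩
    | 1, hj => exact Or.inr (Or.inr (Or.inr (Or.inl ⟨rfl, cof_of_eq_standardCopy hj,
        hasTopClass_of_eq_standardCopy hj, not_nonstandard_of_eq_standardCopy hj⟩)))
    | 2, hj => exact Or.inr (Or.inl ⟨rfl, hj⟩)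
    | 3, hj => exact Or.inr (Or.inr (Or.inl ⟨rfl, hj⟩))
    | 4, hj => exact Or.inr (Or.inr (Or.inr (Or.inr ⟨rfl, hj.2.1, hj.2.2, hj.1⟩)))
  rcases hcof k h with ⟨rfl, c⟩ | ⟨rfl, c⟩ | ⟨rfl, c, h2⟩ | ⟨rfl, c, h2, h3⟩ | ⟨rfl, c, h2, h3⟩ <;>
  rcases hcof k' h' with ⟨rfl, c'⟩ | ⟨rfl, c'⟩ | ⟨rfl, c', h2'⟩ | ⟨rfl, c', h2', h3'⟩ |
    ⟨rfl, c', h2', h3'⟩ <;> clear hcof h h' <;> rw [c] at c' <;> simp_all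

/-! ### Every kind occurs -/

/-- By countable saturation it suffices to bound finitely many terms at each index; their sum plus
one does so. -/
theorem exists_forall_lt [Countable I] (hD : ∀ i : I, D ≠ pure i) (s : ℕ → NatUltrapower D) :
    ∃ x, ∀ k, s k < x := by
  have hrep : ∀ x : NatUltrapower D, ∃ f : I → ℕ, x = (f : (D : Filter I).Germ ℕ) := fun x =>
    Filter.Germ.inductionOn x fun f => ⟨f, rfl⟩
  choose f hf using fun k => hrep (s k)
  obtain ⟨g, hg⟩ := Ultrafilter.exists_forall_eventually hD (p := fun k i z => f k i < z)
    fun n => Filter.Eventually.of_forall fun i => ⟨(∑ k ∈ Finset.range n, f k i) + 1, fun k hk =>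
      Nat.lt_succ_of_le (Finset.single_le_sum (f := fun k => f k i) (fun _ _ => Nat.zero_le _)
        (Finset.mem_range.2 hk))⟩
  refine ⟨(g : (D : Filter I).Germ ℕ), fun k => ?_⟩
  rw [hf, coe_lt]
  exact hg k

theorem exists_infinite [Countable I] (hD : ∀ i : I, D ≠ pure i) :
    ∃ x : NatUltrapower D, ∀ n : ℕ, (n : NatUltrapower D) < x := exists_forall_lt hD _

theorem hasKind_zero (D : Ultrafilter I) : ∃ Δ : ConvexSubsemigroup D, Δ.HasKind 0 :=
  ⟨ofIsLowerSet ⊥ fun a b hab ha => by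
    rw [SetLike.mem_coe, AddSubmonoid.mem_bot] at ha ⊢
    exact le_antisymm (hab.trans ha.le) zero_le, rfl⟩

theorem hasKind_one (D : Ultrafilter I) : ∃ Δ : ConvexSubsemigroup D, Δ.HasKind 1 :=
  ⟨ofIsLowerSet (standardCopy D) (by
    rintro _ b hab ⟨n, rfl⟩
    exact mem_standardCopy_of_le hab), rfl⟩

/-- The whole ultrapower is an example, since no sequence is cofinal in it. -/
theorem hasKind_two (hCH : continuum.{0} = aleph.{0} 1) [Countable I] (hD : ∀ i : I, D ≠ pure i) :
    ∃ Δ : ConvexSubsemigroup D, Δ.HasKind 2 := by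
  let Δ : ConvexSubsemigroup D := ofIsLowerSet ⊤ (by simpa using isLowerSet_univ)
  have h0 : Δ.toAddSubmonoid ≠ ⊥ := fun h =>
    one_ne_zero (α := NatUltrapower D) (AddSubmonoid.mem_bot.1 (h ▸ AddSubmonoid.mem_top 1))
  refine ⟨Δ, (cof_eq_aleph0_or_aleph1 hCH h0).resolve_left fun h => ?_⟩
  obtain ⟨s, hs⟩ := exists_cofinal_sequence h
  obtain ⟨x, hx⟩ := exists_forall_lt hD fun k => (s k : NatUltrapower D)
  obtain ⟨i, hi⟩ := hs ⟨x, AddSubmonoid.mem_top x⟩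
  exact (hx i).not_ge hi

/-- The example consists of the elements below some power of an infinite `x`. The sum of two such
elements is below a power because `2 < x`, and no class is on top because `n * x ^ k < x ^ (k + 1)`.
-/
theorem hasKind_three [Countable I] (hD : ∀ i : I, D ≠ pure i) :
    ∃ Δ : ConvexSubsemigroup D, Δ.HasKind 3 := by
  obtain ⟨x, hx⟩ := exists_infinite hD
  have h1 : 1 ≤ x := by simpa using (hx 1).le
  let S : AddSubmonoid (NatUltrapower D) :=
    { carrier := {y | ∃ n : ℕ, y ≤ x ^ n}
      zero_mem' := ⟨0, zero_le⟩
      add_mem' := by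
        rintro a b ⟨n, hn⟩ ⟨m, hm⟩
        refine ⟨n + m + 1, ?_⟩
        have h2 : a ≤ x ^ (n + m) := hn.trans (pow_le_pow_right₀ h1 (by omega))
        have h3 : b ≤ x ^ (n + m) := hm.trans (pow_le_pow_right₀ h1 (by omega))
        calc a + b ≤ x ^ (n + m) * (2 : ℕ) := by
              rw [Nat.cast_two, mul_two]; exact add_le_add h2 h3
          _ ≤ x ^ (n + m) * x := mul_le_mul_of_nonneg_left (hx 2).le zero_le
          _ = x ^ (n + m + 1) := (pow_succ _ _).symm }
  let Δ : ConvexSubsemigroup D := ofIsLowerSet S (by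
    rintro a b hab ⟨n, hn⟩
    exact ⟨n, hab.trans hn⟩)
  have hmem : ∀ n : ℕ, x ^ n ∈ Δ.toAddSubmonoid := fun n => ⟨n, le_rfl⟩
  have h0 : Δ.toAddSubmonoid ≠ ⊥ := fun h => by
    have h2 := hmem 0
    rw [h, AddSubmonoid.mem_bot, pow_zero] at h2
    exact one_ne_zero h2
  refine ⟨Δ, cof_eq_aleph0_of_sequence h0 (fun n => ⟨x ^ n, hmem n⟩) fun b => b.2, fun h => ?_⟩
  obtain ⟨⟨a, k, hk⟩, -, ha⟩ := hasTopClass_iff.1 h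
  obtain ⟨n, hn⟩ := ha ⟨x ^ (k + 1), hmem _⟩
  have hn' : x ^ (k + 1) ≤ n • a := hn
  have hpos : 0 < x ^ k := pow_pos (one_pos.trans_le h1) k
  have h2 : n • a ≤ n * x ^ k := by
    rw [nsmul_eq_mul]; exact mul_le_mul_of_nonneg_left hk zero_le
  have h3 : n * x ^ k < x * x ^ k := mul_lt_mul_of_pos_right (hx n) hpos
  rw [pow_succ'] at hn'
  exact (hn'.trans h2).not_gt h3

/-- The example consists of the elements below some multiple of an infinite `x`, whose class is then
on top. -/
theorem hasKind_four [Countable I] (hD : ∀ i : I, D ≠ pure i) :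
    ∃ Δ : ConvexSubsemigroup D, Δ.HasKind 4 := by
  obtain ⟨x, hx⟩ := exists_infinite hD
  let S : AddSubmonoid (NatUltrapower D) :=
    { carrier := {y | ∃ n : ℕ, y ≤ n • x}
      zero_mem' := ⟨0, zero_le⟩
      add_mem' := by
        rintro a b ⟨n, hn⟩ ⟨m, hm⟩
        exact ⟨n + m, by rw [add_nsmul]; exact add_le_add hn hm⟩ }
  let Δ : ConvexSubsemigroup D := ofIsLowerSet S (by
    rintro a b hab ⟨n, hn⟩
    exact ⟨n, hab.trans hn⟩)
  have hmem : ∀ n : ℕ, n • x ∈ Δ.toAddSubmonoid := fun n => ⟨n, le_rfl⟩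
  have hxΔ : x ∈ Δ.toAddSubmonoid := ⟨1, (one_nsmul x).ge⟩
  have hx0 : x ≠ 0 := by simpa using (hx 0).ne'
  have h0 : Δ.toAddSubmonoid ≠ ⊥ := fun h => by
    rw [h, AddSubmonoid.mem_bot] at hxΔ
    exact hx0 hxΔ
  exact ⟨Δ, ⟨x, hxΔ, hx⟩, cof_eq_aleph0_of_sequence h0 (fun n => ⟨n • x, hmem n⟩) fun b => b.2,
    hasTopClass_iff.2 ⟨⟨x, hxΔ⟩, fun h => hx0 (congrArg Subtype.val h), fun b => b.2⟩⟩

theorem exists_of_kind (hCH : continuum.{0} = aleph.{0} 1) [Countable I]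
    (hD : ∀ i : I, D ≠ pure i) (k : Fin 5) : ∃ Δ : ConvexSubsemigroup D, Δ.HasKind k :=
  match k with
  | 0 => hasKind_zero D
  | 1 => hasKind_one D
  | 2 => hasKind_two hCH hD
  | 3 => hasKind_three hD
  | 4 => hasKind_four hD

/-! ### Isomorphism and kinds -/

theorem ne_bot_of_cof_ne_one (h : Order.cof Δ ≠ 1) : Δ.toAddSubmonoid ≠ ⊥ :=
  fun h0 => h (cof_of_eq_bot h0)

theorem HasKind.iso (hCH : continuum.{0} = aleph.{0} 1) [Countable I]
    (hD : ∀ i : I, D ≠ pure i) {k : Fin 5} (h : Δ.HasKind k) (h' : Δ'.HasKind k) : Δ.Iso Δ' := by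
  have := saturatedIntegers hD
  have hG : #((D : Filter I).Germ ℤ) ≤ aleph 1 := mk_germ_le hCH
  have hω : ∀ {Δ : ConvexSubsemigroup D}, Order.cof Δ = ℵ₀ → Δ.toAddSubmonoid ≠ ⊥ := fun h =>
    ne_bot_of_cof_ne_one (h ▸ one_lt_aleph0.ne')
  match k, h, h' with
  | 0, h, h' => exact ext_toAddSubmonoid (h.trans h'.symm) ▸ ⟨OrderAddMonoidIso.refl _⟩
  | 1, h, h' => exact ext_toAddSubmonoid (h.trans h'.symm) ▸ ⟨OrderAddMonoidIso.refl _⟩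
  | 2, h, h' =>
    have hω₁ : ∀ {Δ : ConvexSubsemigroup D}, Order.cof Δ = aleph 1 → Δ.toAddSubmonoid ≠ ⊥ :=
      fun h => ne_bot_of_cof_ne_one (h ▸ (one_lt_aleph0.trans_le (aleph0_le_aleph 1)).ne')
    obtain ⟨R, hR⟩ := exists_isIsoGraph_of_uncountable_cof hG Δ.hull_isAbsConvex
      Δ'.hull_isAbsConvex (one_mem_hull (hω₁ h)) (one_mem_hull (hω₁ h'))
      (fun C => exists_lt_of_cof_eq_aleph1 h) (fun C => exists_lt_of_cof_eq_aleph1 h')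
    exact Iso.of_isIsoGraph hR
  | 3, h, h' =>
    obtain ⟨x, h1, h2, h3, h4, h5⟩ := exists_sequence_of_not_hasTopClass (hω h.1) h.1 h.2
    obtain ⟨x', h1', h2', h3', h4', h5'⟩ := exists_sequence_of_not_hasTopClass (hω h'.1) h'.1 h'.2
    obtain ⟨R, hR⟩ := exists_isIsoGraph_of_sequence hG Δ.hull_isAbsConvex
      Δ'.hull_isAbsConvex (one_mem_hull (hω h.1)) (one_mem_hull (hω h'.1)) h1 h1' h2 h2' h3 h3'
      h4 h4' h5 h5'
    exact Iso.of_isIsoGraph hR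
  | 4, h, h' =>
    obtain ⟨x, h1, h2, h3, h4⟩ := exists_top_of_hasTopClass h.2.2 h.1
    obtain ⟨x', h1', h2', h3', h4'⟩ := exists_top_of_hasTopClass h'.2.2 h'.1
    obtain ⟨R, hR⟩ := exists_isIsoGraph_of_top hG Δ.hull_isAbsConvex
      Δ'.hull_isAbsConvex (one_mem_hull (hω h.2.1)) (one_mem_hull (hω h'.2.1)) h1 h1' h2 h2' h3 h3'
      h4 h4'
    exact Iso.of_isIsoGraph hR

theorem Iso.symm (h : Δ.Iso Δ') : Δ'.Iso Δ := h.elim fun e => ⟨e.symm⟩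

theorem Iso.cof_eq (h : Δ.Iso Δ') : Order.cof Δ = Order.cof Δ' :=
  h.elim fun e => OrderIso.cof_congr (e : Δ ≃o Δ')

theorem Iso.hasTopClass_iff (h : Δ.Iso Δ') : Δ.HasTopClass ↔ Δ'.HasTopClass :=
  h.elim fun e => ⟨HasTopClass.of_equiv e, HasTopClass.of_equiv e.symm⟩

theorem Iso.eq_bot (h : Δ.Iso Δ') (h0 : Δ.toAddSubmonoid = ⊥) : Δ'.toAddSubmonoid = ⊥ := by
  obtain ⟨e⟩ := h
  have hz : ∀ x : Δ, x = 0 := fun x => Subtype.ext (by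
    have : ∀ y ∈ Δ.toAddSubmonoid, y = 0 := fun y hy => by rwa [h0, AddSubmonoid.mem_bot] at hy
    exact this x x.2)
  rw [AddSubmonoid.eq_bot_iff_forall]
  intro y hy
  have : (⟨y, hy⟩ : Δ') = 0 := by
    rw [← e.apply_symm_apply ⟨y, hy⟩, hz (e.symm ⟨y, hy⟩), map_zero]
  exact congrArg Subtype.val this

/-- The image `a` of `1` generates `Δ'`. As `1` is a multiple of `a`, it follows that `a ≤ 1`, so no
multiple of `a` is infinite. -/
theorem Iso.eq_standardCopy (h : Δ.Iso Δ') (h1 : Δ.toAddSubmonoid = standardCopy D) :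
    Δ'.toAddSubmonoid = standardCopy D := by
  have h0' : Δ'.toAddSubmonoid ≠ ⊥ := fun h0 => ne_bot_of_eq_standardCopy h1 (h.symm.eq_bot h0)
  obtain ⟨e⟩ := h
  set a := e ⟨1, one_mem_of_ne_bot (ne_bot_of_eq_standardCopy h1)⟩ with ha
  have hgen : ∀ y : Δ', ∃ n : ℕ, y = n • a := fun y => by
    obtain ⟨n, hn⟩ := le_nsmul_one_of_eq_standardCopy h1 (e.symm y)
    refine ⟨n, ?_⟩
    rw [ha, ← map_nsmul, ← hn, e.apply_symm_apply]
  obtain ⟨n, hn⟩ := hgen ⟨1, one_mem_of_ne_bot h0'⟩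
  have hn' : (1 : NatUltrapower D) = n • (a : NatUltrapower D) := congrArg Subtype.val hn
  have ha1 : (a : NatUltrapower D) ≤ (1 : ℕ) := by
    rcases n.eq_zero_or_pos with rfl | hpos
    · rw [zero_nsmul] at hn'
      exact (one_ne_zero hn').elim
    · rw [Nat.cast_one, hn']
      exact le_self_nsmul zero_le hpos.ne'
  refine eq_standardCopy_of_not_nonstandard h0' ?_
  rintro ⟨y, hy, hlt⟩
  obtain ⟨m, hm⟩ := hgen ⟨y, hy⟩
  have hm' : y = m • (a : NatUltrapower D) := congrArg Subtype.val hm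
  have h2 := nsmul_le_nsmul_right ha1 m
  rw [← hm', Nat.cast_one, nsmul_one] at h2
  exact (hlt m).not_ge h2

theorem HasKind.of_iso {k : Fin 5} (h : Δ.HasKind k) (hi : Δ.Iso Δ') : Δ'.HasKind k :=
  match k, h with
  | 0, h => hi.eq_bot h
  | 1, h => hi.eq_standardCopy h
  | 2, h => hi.cof_eq.symm.trans h
  | 3, h => ⟨hi.cof_eq.symm.trans h.1, fun ht => h.2 (hi.hasTopClass_iff.2 ht)⟩
  -- Nonstandardness is transferred indirectly: otherwise `Δ'` would be `ω`, hence so would `Δ`.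
  | 4, h => ⟨by
      by_contra hn
      have hc := hi.cof_eq.symm.trans h.2.1
      exact not_nonstandard_of_eq_standardCopy (hi.symm.eq_standardCopy
        (eq_standardCopy_of_not_nonstandard
          (ne_bot_of_cof_ne_one (hc ▸ one_lt_aleph0.ne')) hn)) h.1,
      hi.cof_eq.symm.trans h.2.1, hi.hasTopClass_iff.1 h.2.2⟩

end ConvexSubsemigroup

/-! ### The classification -/

theorem mainTheorem4
    (hCH : Cardinal.continuum.{0} = Cardinal.aleph.{0} 1)
    {I : Type u} [Countable I] (D : Ultrafilter I) (hD : ∀ i : I, D ≠ pure i) :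
    Nat.card (Quotient (ConvexSubsemigroup.isoSetoid D)) = 5 ∧
    (∀ Δ : ConvexSubsemigroup D, ∃! k : Fin 5, Δ.HasKind k) ∧
    (∀ k : Fin 5, ∃ Δ : ConvexSubsemigroup D, Δ.HasKind k) ∧
    (∀ Δ Δ' : ConvexSubsemigroup D,
      Δ.Iso Δ' ↔ ∃ k : Fin 5, Δ.HasKind k ∧ Δ'.HasKind k) := by
  have hiso : ∀ Δ Δ' : ConvexSubsemigroup D,
      Δ.Iso Δ' ↔ ∃ k : Fin 5, Δ.HasKind k ∧ Δ'.HasKind k := fun Δ Δ' =>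
    ⟨fun h => (Δ.exists_hasKind hCH).imp fun k hk => ⟨hk, hk.of_iso h⟩,
      fun ⟨_, h, h'⟩ => h.iso hCH hD h'⟩
  refine ⟨?_, fun Δ => ?_, ConvexSubsemigroup.exists_of_kind hCH hD, hiso⟩
  -- One representative for each kind gives a bijection from `Fin 5` to the isomorphism types.
  · choose F hF using ConvexSubsemigroup.exists_of_kind hCH hD
    have hbij : Function.Bijective
        fun k => (Quotient.mk (ConvexSubsemigroup.isoSetoid D) (F k)) := by
      constructor
      · intro k k' h
        obtain ⟨j, hj, hj'⟩ := (hiso _ _).1 (Quotient.exact h)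
        exact ((hF k).unique hj).trans (hj'.unique (hF k'))
      · intro q
        induction q using Quotient.inductionOn with
        | _ Δ =>
        obtain ⟨k, hk⟩ := Δ.exists_hasKind hCH
        exact ⟨k, Quotient.sound ((hiso _ _).2 ⟨k, hF k, hk⟩)⟩
    rw [← Nat.card_eq_of_bijective _ hbij, Nat.card_fin]
  · obtain ⟨k, hk⟩ := Δ.exists_hasKind hCH
    exact ⟨k, hk, fun j hj => hj.unique hk⟩
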